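/- Let $d\ge 1$ and $b\ge 2$ be integers and let $A\in\mathbb{R}^{d\times d}$. Notation. For $x\in\mathbb{R}\setminus\{0\}$ let $S_b(x)=b^{\log_b|x|-\lfloor \log_b|x|\rfloor}\in[1,b)$ be its base-$b$ significand, and put $S_b(0)=0$. A real sequence $(x_n)_{n\ge 1}$ is *$b$-Benford* if $$\lim_{N\to\infty}\frac{\#\{1\le n\le N: S_b(x_n)\le s\}}{N}=\log_b s\qquad\text{for all } s\in[1,b).$$ Let $\arg z\in(-\pi,\pi]$ be the principal argument of $z\in\mathbb{C}\setminus\{0\}$. A non-empty set $Z\subset\{z\in\mathbb{C}:|z|=r\}$ with $r>0$ is *$b$-nonresonant* if $\Delta_Z:=\{1+\frac{\arg z-\arg w}{2\pi}: z,w\in Z\}$ satisfies both $\Delta_Z\cap\mathbb{Q}=\{1\}$ and $\log_b r\notin\operatorname{span}_{\mathbb{Q}}\Delta_Z$. An arbitrary set $Z\subset\mathbb{C}$ is *$b$-nonresonant* if for every $r>0$ the set $Z\cap\{|z|=r\}$ is either $b$-nonresonant or empty. For $B\in\mathbb{R}^{d\times d}$ let $\sigma(B)\subset\mathbb{C}$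 be its set of eigenvalues and $r_\sigma(B)=\max\{|\lambda|:\lambda\in\sigma(B)\}$ its spectral radius. For $\lambda\in\sigma(B)$ put $M_\lambda=B-\lambda I_d$ if $\lambda\in\mathbb{R}$ and $M_\lambda=B^2-2(\operatorname{Re}\lambda)B+|\lambda|^2I_d$ if $\lambda\notin\mathbb{R}$, and let $k(\lambda)\in\{0,\dots,d-1\}$ be the largest integer $k$ with $\operatorname{rank}M_\lambda^{k+1}<\operatorname{rank}M_\lambda^{k}$ (so $k(\lambda)+1$ is the size of the largest Jordan block of $B$ for $\lambda$). The *extremal peripheral spectrum* of $B$ is $$\sigma_{EP}(B)=\{\lambda\in\sigma(B): |\lambda|=r_\sigma(B),\ k(\lambda)=k_{\max}\},\qquad k_{\max}=\max\{k(\mu):\mu\in\sigma(B),\ |\mu|=r_\sigma(B)\}.$$ Finally, $|B|=\max\{|Bx|: x\in\mathbb{R}^d,\ |x|=1\}$ is the spectral norm, induced by the Euclidean norm on $\mathbb{R}^d$. Theorem. If $\sigma_{EP}(A^N)$ is $b$-nonresonant for some integer $N\ge 1$, then either the sequence $(|A^n|)_{n\ge1}$ is $b$-Benford or $A$ is nilpotent.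 -/

import Mathlib

open Filter Topology

namespace BenfordLinear

noncomputable section

/-- The base-`b` significand `S_b(x)`: the number in `[1, b)` with `|x| = S_b(x) * b ^ k` for an
integer `k` if `x ≠ 0`, and `S_b(0) = 0`. -/
def significand (b : ℕ) (x : ℝ) : ℝ :=
  if x = 0 then 0
  else (b : ℝ) ^ (Real.logb b |x| - (⌊Real.logb b |x|⌋ : ℝ))

/-- A real sequence `(x_n)_{n ≥ 1}` is `b`-Benford if, for every `s ∈ [1, b)`, the proportion of
those `n ∈ {1, …, N}` with `S_b(x_n) ≤ s` tends to `log_b s` as `N → ∞`. -/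
def IsBenford (b : ℕ) (x : ℕ → ℝ) : Prop :=
  ∀ s : ℝ, 1 ≤ s → s < b →
    Tendsto
      (fun N : ℕ => (Set.ncard {n : ℕ | 1 ≤ n ∧ n ≤ N ∧ significand b (x n) ≤ s} : ℝ) / (N : ℝ))
      atTop (𝓝 (Real.logb b s))

/-- `Δ_Z = {1 + (arg z - arg w) / (2π) : z, w ∈ Z}`, with `arg` valued in `(-π, π]`. -/
def argDiff (Z : Set ℂ) : Set ℝ :=
  {t : ℝ | ∃ z ∈ Z, ∃ w ∈ Z, t = 1 + (Complex.arg z - Complex.arg w) / (2 * Real.pi)}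

/-- The `b`-nonresonance condition for a non-empty set `Z` contained in the circle of radius
`r > 0` about the origin. -/
def NonresonantOnCircle (b : ℕ) (r : ℝ) (Z : Set ℂ) : Prop :=
  argDiff Z ∩ Set.range (fun q : ℚ => (q : ℝ)) = {1} ∧
    Real.logb b r ∉ Submodule.span ℚ (argDiff Z)

/-- An arbitrary `Z ⊆ ℂ` is `b`-nonresonant if, for every `r > 0`, its part on the circle of
radius `r` about the origin is either `b`-nonresonant or empty. -/
def Nonresonant (b : ℕ) (Z : Set ℂ) : Prop :=
  ∀ r : ℝ, 0 < r →
    NonresonantOnCircle b r (Z ∩ Metric.sphere (0 : ℂ) r) ∨ Z ∩ Metric.sphere (0 : ℂ) r = ∅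

variable {d : ℕ}

/-- A real matrix regarded as a complex matrix. -/
def complexify (A : Matrix (Fin d) (Fin d) ℝ) : Matrix (Fin d) (Fin d) ℂ :=
  A.map (fun t : ℝ => (t : ℂ))

/-- The spectrum `σ(A) ⊆ ℂ` of a real matrix, i.e. the set of its complex eigenvalues. -/
def sigma (A : Matrix (Fin d) (Fin d) ℝ) : Set ℂ :=
  spectrum ℂ (complexify A)

/-- The peripheral spectrum: the eigenvalues whose modulus is the spectral radius
`max {|μ| : μ ∈ σ(A)}`. -/
def peripheral (A : Matrix (Fin d) (Fin d) ℝ) : Set ℂ :=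
  {z : ℂ | z ∈ sigma A ∧ (‖z‖₊ : ENNReal) = spectralRadius ℂ (complexify A)}

/-- The real matrix `A - z I` if `z` is real, and `A² - 2 (Re z) A + |z|² I` otherwise. -/
def factorMatrix (A : Matrix (Fin d) (Fin d) ℝ) (z : ℂ) : Matrix (Fin d) (Fin d) ℝ :=
  if z.im = 0 then A - z.re • (1 : Matrix (Fin d) (Fin d) ℝ)
  else A ^ 2 - (2 * z.re) • A + (‖z‖ ^ 2) • (1 : Matrix (Fin d) (Fin d) ℝ)

/-- `k(z)`, for an eigenvalue `z` of `A`: the largest `k ∈ {0, …, d - 1}` at which the ranks of the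
powers of the above matrix still drop, `rank (· ^ (k + 1)) < rank (· ^ k)`. -/
def jordanIndex (A : Matrix (Fin d) (Fin d) ℝ) (z : ℂ) : ℕ :=
  Nat.findGreatest
    (fun k : ℕ => (factorMatrix A z ^ (k + 1)).rank < (factorMatrix A z ^ k).rank) (d - 1)

/-- `k_max(A)`, the maximum of `k(z)` over the peripheral spectrum of `A`. -/
def maxJordanIndex (A : Matrix (Fin d) (Fin d) ℝ) : ℕ :=
  sSup (jordanIndex A '' peripheral A)

/-- The extremal peripheral spectrum `σ_EP(A)`. -/
def sigmaEP (A : Matrix (Fin d) (Fin d) ℝ) : Set ℂ :=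
  {z : ℂ | z ∈ peripheral A ∧ jordanIndex A z = maxJordanIndex A}

/-- The spectral norm `|A| = max {|A x| : |x| = 1}`, the operator norm of `A` with respect to the
Euclidean norm on `ℝ^d`. -/
def euclideanOpNorm (A : Matrix (Fin d) (Fin d) ℝ) : ℝ :=
  ‖Matrix.toEuclideanCLM (n := Fin d) (𝕜 := ℝ) A‖

end

end BenfordLinear

/-! By Weyl's criterion, Benford's law for `x_n` means that `exp (2πi h log_b x_n)` has Cesàro mean
zero for every integer `h ≠ 0`. Put `B = A ^ N`. Splitting the indices into residue classes modulo
`N` reduces the claim to the norms `|C * B ^ n|`, where `C` is a power of `A`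
(`MeanZero.of_residues`).

Jordan theory gives `B ^ n ≈ r ^ n * n ^ k * ∑ (z / r) ^ n • P z`, where `z` runs over a non-empty
part of `σ_EP(B)` and `P z` is an eigenvector of left multiplication by `B`
(`exists_pow_asymptotics`). Hence `|C * B ^ n|` is asymptotic to `r ^ n * n ^ k * g (n • θ)`, with
`g` continuous on a torus and `θ` the vector of arguments divided by `2π`. Since `C` divides a power
of `B`, and eigenvectors for distinct eigenvalues are independent, `g` is positive everywhere, so
its logarithm is continuous.

The Weyl sum thus averages `ω ^ n * s n * G (n • θ)`, with `ω = exp (2πi h log_b r)` and `s n`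
coming from `n ^ k`, hence slowly varying. Approximating `G` by trigonometric polynomials leaves
modulated geometric sequences, of mean zero unless the ratio is 1 (`meanZero_torus`,
`MeanZero.geometric_mul`). Ratio 1 would be an integer relation between `log_b r`, the arguments and
1. As `σ_EP(B)` is closed under conjugation, such a relation would place `log_b r` in the rational
span of `Δ`, against nonresonance (`no_integer_relation`). -/

/-- The Cesàro means of the complex sequence `a` tend to zero. -/
def MeanZero (a : ℕ → ℂ) : Prop :=
  Tendsto (fun N : ℕ => (N : ℝ)⁻¹ • ∑ i ∈ Finset.range N, a i) atTop (𝓝 0)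

/-! ### Sequences with vanishing Cesàro means. -/

namespace MeanZero

theorem of_tendsto {a : ℕ → ℂ} (h : Tendsto a atTop (𝓝 0)) : MeanZero a := h.cesaro_smul

theorem congr {a c : ℕ → ℂ} (ha : MeanZero a) (h : ∀ n, a n = c n) : MeanZero c :=
  (funext h : a = c) ▸ ha

theorem add {a c : ℕ → ℂ} (ha : MeanZero a) (hc : MeanZero c) :
    MeanZero (fun n => a n + c n) := by
  have := Tendsto.add ha hc
  simpa [MeanZero, Finset.sum_add_distrib, mul_add] using this

theorem const_mul {a : ℕ → ℂ} (z : ℂ) (ha : MeanZero a) : MeanZero (fun n => z * a n) := by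
  have := Tendsto.const_mul z ha
  simp only [mul_zero] at this
  refine this.congr fun N => ?_
  rw [← Finset.mul_sum, mul_smul_comm]

theorem of_sub_tendsto {a c : ℕ → ℂ} (hc : MeanZero c)
    (h : Tendsto (fun n => a n - c n) atTop (𝓝 0)) : MeanZero a := by
  simpa using hc.add (of_tendsto h)

theorem of_bounded_sum {a : ℕ → ℂ} {K : ℝ} (h : ∀ N, ‖∑ i ∈ Finset.range N, a i‖ ≤ K) :
    MeanZero a := by
  refine squeeze_zero_norm (a := fun N : ℕ => (N : ℝ)⁻¹ * K) (fun N => ?_) ?_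
  · rw [norm_smul, Real.norm_of_nonneg (by positivity)]
    exact mul_le_mul_of_nonneg_left (h N) (by positivity)
  · simpa using (tendsto_inv_atTop_nhds_zero_nat (𝕜 := ℝ)).mul_const K

/-- Geometric sequences on the unit circle remain of mean zero when they are modulated by a
bounded slowly varying sequence. -/
theorem geometric_mul {z : ℂ} (hz : ‖z‖ = 1) (hz1 : z ≠ 1) {s : ℕ → ℂ} (hs : ∀ n, ‖s n‖ ≤ 1)
    (hd : Tendsto (fun n => s (n + 1) - s n) atTop (𝓝 0)) : MeanZero (fun n => z ^ n * s n) := by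
  -- Summation by parts: this telescoping difference equals `(z - 1) * (z ^ n * s n)` plus a term
  -- that tends to zero, and `z - 1` can be divided out.
  have h1 : MeanZero (fun n => z ^ (n + 1) * s (n + 1) - z ^ n * s n) := by
    refine of_bounded_sum (K := 2) fun N => ?_
    rw [Finset.sum_range_sub (fun n => z ^ n * s n)]
    refine (norm_sub_le _ _).trans ?_
    have hb : ∀ n, ‖z ^ n * s n‖ ≤ 1 := fun n => by simpa [hz] using hs n
    linarith [hb N, hb 0]
  have h2 : Tendsto (fun n => z ^ (n + 1) * (s (n + 1) - s n)) atTop (𝓝 0) := by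
    rw [tendsto_zero_iff_norm_tendsto_zero] at hd ⊢
    simpa [hz] using hd
  have h3 := (h1.add ((of_tendsto h2).const_mul (-1))).const_mul (z - 1)⁻¹
  have hne : z - 1 ≠ 0 := sub_ne_zero.mpr hz1
  convert h3 using 2 with n
  field_simp
  ring

/-- A bounded sequence has mean zero if its restriction to every residue class has mean zero. -/
theorem of_residues {a : ℕ → ℂ} {q : ℕ} (hq : 0 < q) (hb : ∀ n, ‖a n‖ ≤ 1)
    (h : ∀ j < q, MeanZero (fun n => a (q * n + j))) : MeanZero a := by
  have hsplit : ∀ K, ∑ i ∈ Finset.range (q * K), a i =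
      ∑ j ∈ Finset.range q, ∑ n ∈ Finset.range K, a (q * n + j) := by
    intro K
    induction K with
    | zero => simp
    | succ K ih =>
      rw [mul_add, mul_one, Finset.sum_range_add, ih, ← Finset.sum_add_distrib]
      exact Finset.sum_congr rfl fun j _ => by rw [Finset.sum_range_succ]
  have hdiv : Tendsto (fun N : ℕ => N / q) atTop atTop := Nat.tendsto_div_const_atTop hq.ne'
  have h1 : Tendsto (fun N : ℕ => ∑ j ∈ Finset.range q, ‖((N / q : ℕ) : ℝ)⁻¹ •
      ∑ n ∈ Finset.range (N / q), a (q * n + j)‖) atTop (𝓝 0) := by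
    have := tendsto_finsetSum (Finset.range q) fun j hj =>
      ((h j (Finset.mem_range.mp hj)).comp hdiv).norm
    simpa using this
  -- This bounds the incomplete last block, which has fewer than `q` terms of norm at most 1.
  have h2 : Tendsto (fun N : ℕ => (N : ℝ)⁻¹ * q) atTop (𝓝 0) := by
    simpa using (tendsto_inv_atTop_nhds_zero_nat (𝕜 := ℝ)).mul_const (q : ℝ)
  have h3 := h1.add h2
  rw [add_zero] at h3
  refine squeeze_zero_norm' ?_ h3
  filter_upwards [eventually_ge_atTop q] with N hN
  have hN0 : 0 < N := hq.trans_le hN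
  have hK : 0 < N / q := Nat.div_pos hN hq
  have hN' : (0 : ℝ) < N := by exact_mod_cast hN0
  have hK' : (0 : ℝ) < ((N / q : ℕ) : ℝ) := by exact_mod_cast hK
  have hKN : ((N / q : ℕ) : ℝ) ≤ N := by exact_mod_cast Nat.div_le_self N q
  conv_lhs => rw [← Nat.div_add_mod N q]
  rw [Finset.sum_range_add, hsplit, Nat.div_add_mod, smul_add]
  refine (norm_add_le _ _).trans (add_le_add ?_ ?_)
  · rw [Finset.smul_sum]
    refine (norm_sum_le _ _).trans (Finset.sum_le_sum fun j _ => ?_)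
    rw [norm_smul, norm_smul, Real.norm_of_nonneg (by positivity),
      Real.norm_of_nonneg (by positivity)]
    exact mul_le_mul_of_nonneg_right (inv_anti₀ hK' hKN) (norm_nonneg _)
  · rw [norm_smul, Real.norm_of_nonneg (by positivity)]
    refine mul_le_mul_of_nonneg_left ?_ (by positivity)
    refine (norm_sum_le _ _).trans ((Finset.sum_le_sum fun j _ => hb _).trans ?_)
    have : ((N % q : ℕ) : ℝ) ≤ q := by exact_mod_cast (Nat.mod_lt N hq).le
    simpa using this

/-- If uniformly bounded functionals have mean zero on a spanning set of a dense subspace, then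
they have mean zero everywhere. -/
theorem of_dense_span {E : Type*} [NormedAddCommGroup E] [NormedSpace ℂ E] {S : Set E}
    (hS : (Submodule.span ℂ S).topologicalClosure = ⊤) (L : ℕ → E →ₗ[ℂ] ℂ) {K : ℝ}
    (hK : ∀ n f, ‖L n f‖ ≤ K * ‖f‖) (h : ∀ f ∈ S, MeanZero (fun n => L n f)) (f : E) :
    MeanZero (fun n => L n f) := by
  have hspan : ∀ g ∈ Submodule.span ℂ S, MeanZero (fun n => L n g) := by
    intro g hg
    induction hg using Submodule.span_induction with
    | mem x hx => exact h x hx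
    | zero => exact of_tendsto (by simp)
    | add x y _ _ hx hy => simpa using hx.add hy
    | smul c x _ hx => simpa using hx.const_mul c
  have hf : f ∈ closure ((Submodule.span ℂ S : Submodule ℂ E) : Set E) := by
    rw [← Submodule.topologicalClosure_coe, hS]; trivial
  rw [MeanZero, Metric.tendsto_atTop]
  intro ε hε
  obtain ⟨g, hg, hfg⟩ := Metric.mem_closure_iff.mp hf (ε / (2 * (|K| + 1))) (by positivity)
  obtain ⟨N₀, hN₀⟩ := Metric.tendsto_atTop.mp (hspan g hg) (ε / 2) (by positivity)
  refine ⟨N₀, fun N hN => ?_⟩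
  have hg' := hN₀ N hN
  rw [dist_zero_right] at hg' ⊢
  have hsub : ‖(N : ℝ)⁻¹ • ∑ i ∈ Finset.range N, L i (f - g)‖ ≤ |K| * ‖f - g‖ := by
    rw [norm_smul, Real.norm_of_nonneg (by positivity)]
    have h1 : ‖∑ i ∈ Finset.range N, L i (f - g)‖ ≤ N * (|K| * ‖f - g‖) := by
      refine (norm_sum_le _ _).trans ((Finset.sum_le_sum fun i _ => (hK i (f - g)).trans
        (mul_le_mul_of_nonneg_right (le_abs_self K) (norm_nonneg _))).trans ?_)
      simp
    rcases Nat.eq_zero_or_pos N with rfl | hN0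
    · simp; positivity
    · have : (0 : ℝ) < N := by exact_mod_cast hN0
      calc (N : ℝ)⁻¹ * ‖∑ i ∈ Finset.range N, L i (f - g)‖
          ≤ (N : ℝ)⁻¹ * (N * (|K| * ‖f - g‖)) := mul_le_mul_of_nonneg_left h1 (by positivity)
        _ = |K| * ‖f - g‖ := by field_simp
  have hsub2 : |K| * ‖f - g‖ ≤ ε / 2 := by
    rw [dist_eq_norm] at hfg
    have : |K| * ‖f - g‖ ≤ (|K| + 1) * (ε / (2 * (|K| + 1))) :=
      mul_le_mul (by linarith) hfg.le (norm_nonneg _) (by positivity)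
    refine this.trans (le_of_eq ?_)
    field_simp
  have heq : (N : ℝ)⁻¹ • ∑ i ∈ Finset.range N, L i f =
      (N : ℝ)⁻¹ • ∑ i ∈ Finset.range N, L i (f - g) +
        (N : ℝ)⁻¹ • ∑ i ∈ Finset.range N, L i g := by
    rw [← smul_add, ← Finset.sum_add_distrib]
    simp
  rw [heq]
  exact (norm_add_le _ _).trans_lt (by linarith)

end MeanZero

/-! ### Weyl's equidistribution criterion on the circle. -/

section Weyl

open MeasureTheory

instance : IsProbabilityMeasure (volume : Measure UnitAddCircle) :=
  ⟨UnitAddCircle.measure_univ⟩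

/-- Translation by `1 / (2h)` preserves the measure and changes the sign of the character. -/
theorem integral_fourier_eq_zero {h : ℤ} (hh : h ≠ 0) :
    ∫ x : UnitAddCircle, fourier h x = 0 :=
  integral_eq_zero_of_add_right_eq_neg (fourier_add_half_inv_index hh one_pos)

/-- The Weyl sums of `y` control the averages of all continuous functions along `y`. -/
theorem meanZero_sub_integral_of_fourier {y : ℕ → UnitAddCircle}
    (h : ∀ k : ℤ, k ≠ 0 → MeanZero (fun n => fourier k (y n))) (f : C(UnitAddCircle, ℂ)) :
    MeanZero (fun n => f (y n) - ∫ x, f x) := by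
  have hint : ∀ f : C(UnitAddCircle, ℂ), Integrable (fun x => f x) volume := fun f =>
    f.continuous.integrable_of_hasCompactSupport (HasCompactSupport.of_compactSpace _)
  let L : ℕ → C(UnitAddCircle, ℂ) →ₗ[ℂ] ℂ := fun n =>
    { toFun := fun f => f (y n) - ∫ x, f x
      map_add' := fun f g => by
        simp only [ContinuousMap.add_apply]
        rw [integral_add (hint f) (hint g)]
        ring
      map_smul' := fun c f => by
        simp only [ContinuousMap.smul_apply, integral_smul, RingHom.id_apply, smul_sub] }
  refine MeanZero.of_dense_span span_fourier_closure_eq_top L (K := 2) (fun n f => ?_) ?_ f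
  · refine (norm_sub_le _ _).trans ?_
    have h1 := f.norm_coe_le_norm (y n)
    have h2 : ‖∫ x, f x‖ ≤ ‖f‖ := by
      have := norm_integral_le_of_norm_le_const (μ := (volume : Measure UnitAddCircle))
        (f := fun x => f x) (Eventually.of_forall fun x => f.norm_coe_le_norm x)
      simpa [Measure.real] using this
    linarith
  · rintro _ ⟨k, rfl⟩
    change MeanZero (fun n => fourier k (y n) - ∫ x : UnitAddCircle, fourier k x)
    by_cases hk : k = 0
    · subst hk
      refine MeanZero.of_tendsto ?_
      simp [Measure.real]
    · simpa only [integral_fourier_eq_zero hk, sub_zero] using h k hk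

/-- The uniform distribution on the first `N + 1` terms of a sequence. -/
noncomputable def empiricalMeasure (y : ℕ → UnitAddCircle) (N : ℕ) : Measure UnitAddCircle :=
  (((N + 1 : ℕ) : ENNReal))⁻¹ • ∑ i ∈ Finset.range (N + 1), Measure.dirac (y i)

instance (y : ℕ → UnitAddCircle) (N : ℕ) : IsProbabilityMeasure (empiricalMeasure y N) := by
  constructor
  simp only [empiricalMeasure, Measure.smul_apply, Measure.finsetSum_apply, measure_univ,
    Finset.sum_const, Finset.card_range, smul_eq_mul, nsmul_eq_mul, mul_one]
  exact ENNReal.inv_mul_cancel (by simp) (by simp)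

theorem integral_empiricalMeasure (y : ℕ → UnitAddCircle) (N : ℕ)
    (f : BoundedContinuousFunction UnitAddCircle ℝ) :
    ∫ x, f x ∂(empiricalMeasure y N) =
      ((N + 1 : ℕ) : ℝ)⁻¹ * ∑ i ∈ Finset.range (N + 1), f (y i) := by
  rw [empiricalMeasure, integral_smul_measure, integral_finsetSum_measure]
  · simp only [integral_dirac, ENNReal.toReal_inv, ENNReal.toReal_natCast, smul_eq_mul]
  · exact fun i _ => f.integrable _

theorem empiricalMeasure_real (y : ℕ → UnitAddCircle) (N : ℕ) {E : Set UnitAddCircle}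
    (hE : MeasurableSet E) [DecidablePred (· ∈ E)] :
    (empiricalMeasure y N).real E =
      (((Finset.range (N + 1)).filter (fun i => y i ∈ E)).card : ℝ) / ((N + 1 : ℕ) : ℝ) := by
  have : ∑ i ∈ Finset.range (N + 1), (Measure.dirac (y i)) E =
      (((Finset.range (N + 1)).filter (fun i => y i ∈ E)).card : ENNReal) := by
    rw [Finset.card_filter]
    push_cast
    refine Finset.sum_congr rfl fun i _ => ?_
    rw [Measure.dirac_apply' _ hE]
    by_cases h : y i ∈ E <;> simp [h]
  rw [Measure.real, empiricalMeasure, Measure.smul_apply, Measure.finsetSum_apply, this]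
  rw [smul_eq_mul, ENNReal.toReal_mul, ENNReal.toReal_inv, ENNReal.toReal_natCast,
    ENNReal.toReal_natCast, div_eq_inv_mul]

/-- `empiricalMeasure` as a bundled probability measure. -/
noncomputable def empiricalProbability (y : ℕ → UnitAddCircle) (N : ℕ) :
    ProbabilityMeasure UnitAddCircle :=
  ⟨empiricalMeasure y N, inferInstance⟩

/-- The uniform distribution on the circle as a bundled probability measure. -/
noncomputable def uniformProbability : ProbabilityMeasure UnitAddCircle :=
  ⟨volume, inferInstance⟩

/-- Weak convergence is tested on real functions: regard them as complex, apply the previous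
averages and take real parts. -/
theorem tendsto_empiricalProbability {y : ℕ → UnitAddCircle}
    (h : ∀ k : ℤ, k ≠ 0 → MeanZero (fun n => fourier k (y n))) :
    Tendsto (empiricalProbability y) atTop (𝓝 uniformProbability) := by
  rw [ProbabilityMeasure.tendsto_iff_forall_integral_tendsto]
  intro f
  let g : C(UnitAddCircle, ℂ) := ⟨fun x => (f x : ℂ), Complex.continuous_ofReal.comp f.continuous⟩
  have hg := (meanZero_sub_integral_of_fourier h g).comp (tendsto_add_atTop_nat 1)
  have hre := (Complex.continuous_re.tendsto _).comp hg
  have h0 : ∫ x, g x = ((∫ x, f x : ℝ) : ℂ) := integral_ofReal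
  change Tendsto (fun N => ∫ x, f x ∂(empiricalMeasure y N)) atTop (𝓝 (∫ x, f x))
  rw [tendsto_iff_norm_sub_tendsto_zero]
  rw [Complex.zero_re] at hre
  refine (hre.norm.congr fun N => ?_).trans (by simp)
  rw [integral_empiricalMeasure]
  congr 1
  simp only [Function.comp_apply, h0]
  have : ∑ i ∈ Finset.range (N + 1), (g (y i) - ((∫ x, f x : ℝ) : ℂ)) =
      ((∑ i ∈ Finset.range (N + 1), (f (y i) - ∫ x, f x) : ℝ) : ℂ) := by
    push_cast; rfl
  rw [this, Complex.smul_re, Complex.ofReal_re, Finset.sum_sub_distrib, smul_eq_mul, mul_sub]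
  have hN : ((N + 1 : ℕ) : ℝ) ≠ 0 := by positivity
  simp only [Finset.sum_const, Finset.card_range, nsmul_eq_mul]
  rw [inv_mul_cancel_left₀ hN]

theorem coe_fract (x : ℝ) : ((Int.fract x : ℝ) : UnitAddCircle) = x := by
  rw [← sub_eq_zero, ← AddCircle.coe_sub, AddCircle.coe_eq_zero_iff]
  exact ⟨-⌊x⌋, by rw [← Int.self_sub_floor]; simp⟩

theorem mem_image_Icc_iff_fract_le {t x : ℝ} (ht1 : t < 1) :
    (x : UnitAddCircle) ∈ ((↑) : ℝ → UnitAddCircle) '' Set.Icc 0 t ↔ Int.fract x ≤ t := by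
  constructor
  · rintro ⟨z, ⟨hz0, hzt⟩, hzx⟩
    rw [← coe_fract x, AddCircle.coe_eq_coe_iff_of_mem_Ico (a := 0)] at hzx
    · rwa [← hzx]
    · exact ⟨hz0, by linarith⟩
    · exact ⟨Int.fract_nonneg x, by linarith [Int.fract_lt_one x]⟩
  · intro hx
    exact ⟨Int.fract x, ⟨Int.fract_nonneg x, hx⟩, coe_fract x⟩

theorem volume_image_Icc {t : ℝ} (ht1 : t < 1) :
    volume (((↑) : ℝ → UnitAddCircle) '' Set.Icc 0 t) = ENNReal.ofReal t := by
  have hm : MeasurableSet (((↑) : ℝ → UnitAddCircle) '' Set.Icc 0 t) :=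
    (isCompact_Icc.image (AddCircle.continuous_mk' 1)).isClosed.measurableSet
  rw [AddCircle.add_projection_respects_measure 1 0 hm]
  have hvol : volume (Set.Ioc 0 t) = ENNReal.ofReal t := by simp
  have hfr : ∀ x : ℝ, 0 < x → x < 1 → Int.fract x = x := fun x h0 h1 =>
    Int.fract_eq_self.mpr ⟨h0.le, h1⟩
  refine le_antisymm ?_ ?_
  -- In the fundamental domain `Ioc 0 1` the point 0 of the arc is represented by 1, a single extra
  -- point of measure zero.
  · rw [← hvol, ← (insert_ae_eq_self (1 : ℝ) (Set.Ioc 0 t)).measure_eq]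
    refine measure_mono ?_
    rintro x ⟨hx, hx0, hx1⟩
    rw [zero_add] at hx1
    rcases hx1.eq_or_lt with rfl | hx1
    · exact Or.inl rfl
    · have := (mem_image_Icc_iff_fract_le ht1).mp hx
      rw [hfr x hx0 hx1] at this
      exact Or.inr ⟨hx0, this⟩
  · rw [← hvol]
    refine measure_mono ?_
    rintro x ⟨hx0, hxt⟩
    refine ⟨(mem_image_Icc_iff_fract_le ht1).mpr ?_, hx0, by linarith⟩
    rwa [hfr x hx0 (by linarith)]

/-- Weak convergence passes to the measure of a set only when its boundary is null; here the
boundary lies in the two endpoints of the arc. -/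
theorem volume_frontier_image_Icc (t : ℝ) :
    volume (frontier (((↑) : ℝ → UnitAddCircle) '' Set.Icc 0 t)) = 0 := by
  have hc : IsClosed (((↑) : ℝ → UnitAddCircle) '' Set.Icc 0 t) :=
    (isCompact_Icc.image (AddCircle.continuous_mk' 1)).isClosed
  have ho : IsOpen (((↑) : ℝ → UnitAddCircle) '' Set.Ioo 0 t) :=
    QuotientAddGroup.isOpenMap_coe _ isOpen_Ioo
  have hsub : frontier (((↑) : ℝ → UnitAddCircle) '' Set.Icc 0 t) ⊆
      {((0 : ℝ) : UnitAddCircle), (t : UnitAddCircle)} := by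
    rw [hc.frontier_eq]
    rintro _ ⟨⟨x, ⟨hx0, hxt⟩, rfl⟩, hx⟩
    rcases hx0.eq_or_lt with rfl | hx0
    · simp
    rcases hxt.eq_or_lt with rfl | hxt
    · simp
    exact absurd (interior_maximal (Set.image_mono Set.Ioo_subset_Icc_self) ho
      ⟨x, ⟨hx0, hxt⟩, rfl⟩) hx
  have hpt : ∀ x : UnitAddCircle, volume {x} = 0 := fun x => by
    rw [← Metric.closedBall_zero, AddCircle.volume_closedBall]
    simp
  exact measure_mono_null hsub (measure_union_null (hpt _) (hpt _))

/-- **Weyl's criterion**, in terms of fractional parts. -/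
theorem tendsto_card_fract_le {x : ℕ → ℝ}
    (h : ∀ k : ℤ, k ≠ 0 → MeanZero (fun n => fourier k (x n : UnitAddCircle)))
    {t : ℝ} (ht0 : 0 ≤ t) (ht1 : t < 1) :
    Tendsto (fun N : ℕ => (((Finset.range N).filter (fun i => Int.fract (x i) ≤ t)).card : ℝ) / N)
      atTop (𝓝 t) := by
  classical
  rw [← tendsto_add_atTop_iff_nat 1]
  have hm : MeasurableSet (((↑) : ℝ → UnitAddCircle) '' Set.Icc 0 t) :=
    (isCompact_Icc.image (AddCircle.continuous_mk' 1)).isClosed.measurableSet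
  have key := ProbabilityMeasure.tendsto_measure_of_null_frontier_of_tendsto'
    (tendsto_empiricalProbability h) (volume_frontier_image_Icc t)
  change Tendsto _ _ (𝓝 (volume _)) at key
  rw [volume_image_Icc ht1] at key
  have key2 := (ENNReal.tendsto_toReal ENNReal.ofReal_ne_top).comp key
  rw [ENNReal.toReal_ofReal ht0] at key2
  refine key2.congr fun N => ?_
  change (empiricalMeasure _ N).real _ = _
  rw [empiricalMeasure_real _ _ hm]
  simp only [mem_image_Icc_iff_fract_le ht1]

end Weyl

/-! ### From equidistribution modulo 1 to Benford's law. -/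

namespace BenfordLinear

theorem significand_le_iff {b : ℕ} (hb : 2 ≤ b) {x s : ℝ} (hx : 0 < x) (hs : 1 ≤ s) :
    significand b x ≤ s ↔ Int.fract (Real.logb b x) ≤ Real.logb b s := by
  have hb1 : (1 : ℝ) < b := by exact_mod_cast hb
  rw [significand, if_neg hx.ne', abs_of_pos hx, Real.le_logb_iff_rpow_le hb1 (by linarith)]
  rfl

/-- Weyl's criterion for Benford's law. -/
theorem isBenford_of_fourier {b : ℕ} (hb : 2 ≤ b) {x : ℕ → ℝ} (hx : ∀ n, 0 < x (n + 1))
    (h : ∀ k : ℤ, k ≠ 0 →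
      MeanZero (fun n => fourier k (Real.logb b (x (n + 1)) : UnitAddCircle))) :
    IsBenford b x := by
  intro s hs hsb
  have hb1 : (1 : ℝ) < b := by exact_mod_cast hb
  have hs0 : 0 < s := by linarith
  have ht1 : Real.logb b s < 1 := by
    rw [Real.logb_lt_iff_lt_rpow hb1 hs0, Real.rpow_one]; exact hsb
  refine (tendsto_card_fract_le h (Real.logb_nonneg hb1 hs) ht1).congr fun N => ?_
  congr 2
  -- Benford counts run over `1, …, N`, the Weyl counts over `0, …, N - 1`.
  rw [← Set.ncard_coe_finset, ← Set.ncard_image_of_injective _ Nat.succ_injective]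
  congr 1
  ext n
  simp only [Finset.coe_filter, Finset.mem_range, Set.mem_image, Set.mem_ofPred_eq]
  constructor
  · rintro ⟨m, ⟨hm, hms⟩, rfl⟩
    exact ⟨by omega, by omega, (significand_le_iff hb (hx m) hs).mpr hms⟩
  · rintro ⟨h1, h2, h3⟩
    obtain ⟨m, rfl⟩ : ∃ m, n = m + 1 := ⟨n - 1, by omega⟩
    exact ⟨m, ⟨by omega, (significand_le_iff hb (hx m) hs).mp h3⟩, rfl⟩

end BenfordLinear

/-! ### Generalized eigenvectors of left multiplication in an algebra. -/

section GeneralizedEigenspaces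

variable {R : Type*} [Ring R]

/-- Multiplication by `M` still strictly lowers something annihilated by `M ^ (k + 1)`: the
kernels of the left multiplications by `M ^ k` and `M ^ (k + 1)` differ. -/
def HasKernelGrowth (M : R) (k : ℕ) : Prop :=
  ∃ X : R, M ^ (k + 1) * X = 0 ∧ M ^ k * X ≠ 0

theorem HasKernelGrowth.pred {M : R} {k : ℕ} (h : HasKernelGrowth M (k + 1)) :
    HasKernelGrowth M k := by
  obtain ⟨X, h0, h1⟩ := h
  exact ⟨M * X, by rwa [← mul_assoc, ← pow_succ], by rwa [← mul_assoc, ← pow_succ]⟩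

theorem HasKernelGrowth.mono {M : R} {k l : ℕ} (h : HasKernelGrowth M l) (hkl : k ≤ l) :
    HasKernelGrowth M k := by
  induction l, hkl using Nat.le_induction with
  | base => exact h
  | succ l _ ih => exact ih h.pred

/-- The last power of `M` that does not kill `E` has exponent at least `k`, and growth passes down
to smaller exponents. -/
theorem hasKernelGrowth_of_pow_mul {M E : R} {k m : ℕ} (hm : M ^ m * E = 0)
    (hk : M ^ k * E ≠ 0) : HasKernelGrowth M k := by
  induction m with
  | zero => exact absurd (by simp_all) hk
  | succ m ih =>
    by_cases h : M ^ m * E = 0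
    · exact ih h
    · have hkm : k ≤ m := by
        by_contra hlt
        push Not at hlt
        refine hk ?_
        obtain ⟨c, rfl⟩ := Nat.exists_eq_add_of_lt hlt
        rw [show m + c + 1 = c + (m + 1) by ring, pow_add, mul_assoc, hm, mul_zero]
      exact HasKernelGrowth.mono ⟨E, hm, h⟩ hkm

variable [Algebra ℂ R]

/-- `B - z`. -/
def shift (B : R) (z : ℂ) : R := B - algebraMap ℂ R z

theorem mem_spectrum_of_hasKernelGrowth {B : R} {z : ℂ} {k : ℕ}
    (h : HasKernelGrowth (shift B z) k) : z ∈ spectrum ℂ B := by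
  obtain ⟨X, h0, h1⟩ := h.mono (Nat.zero_le k)
  rw [spectrum.mem_iff]
  intro hu
  have hu' : IsUnit (shift B z) := by
    rw [shift, ← neg_sub]; exact hu.neg
  rw [zero_add, pow_one] at h0
  rw [pow_zero, one_mul] at h1
  exact h1 (hu'.mul_right_eq_zero.mp h0)

theorem lmul_sub_pow_apply (B X : R) (z : ℂ) (k : ℕ) :
    ((Algebra.lmul ℂ R B - z • 1) ^ k) X = shift B z ^ k * X := by
  have : Algebra.lmul ℂ R B - z • 1 = Algebra.lmul ℂ R (shift B z) := by
    rw [shift, map_sub, AlgHom.commutes, Algebra.algebraMap_eq_smul_one]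
  rw [this, ← map_pow]
  rfl

theorem mem_maxGenEigenspace_lmul (B X : R) (z : ℂ) :
    X ∈ (Algebra.lmul ℂ R B).maxGenEigenspace z ↔ ∃ k, shift B z ^ k * X = 0 := by
  simp only [Module.End.mem_maxGenEigenspace, lmul_sub_pow_apply]

/-- The unit of a finite-dimensional complex algebra is a sum of generalized eigenvectors of the
left multiplication by `B`. -/
theorem exists_spectral_decomposition [FiniteDimensional ℂ R] (B : R) :
    ∃ E : ℂ →₀ R, (∀ z, ∃ k, shift B z ^ k * E z = 0) ∧ ∑ z ∈ E.support, E z = 1 := by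
  have h1 : (1 : R) ∈ ⨆ z, (Algebra.lmul ℂ R B).maxGenEigenspace z := by
    rw [Module.End.iSup_maxGenEigenspace_eq_top]; trivial
  obtain ⟨E, hE, hsum⟩ := (Submodule.mem_iSup_iff_exists_finsupp _ _).mp h1
  exact ⟨E, fun z => (mem_maxGenEigenspace_lmul B _ z).mp (hE z), hsum⟩

/-- The component at `z` of a spectral decomposition reproduces generalized eigenvectors. -/
theorem component_mul_eq_self {B : R} {E : ℂ →₀ R}
    (hE : ∀ z, ∃ k, shift B z ^ k * E z = 0) (hsum : ∑ z ∈ E.support, E z = 1)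
    {X : R} {z : ℂ} {m : ℕ} (hX : shift B z ^ m * X = 0) : E z * X = X := by
  classical
  have hind := (Algebra.lmul ℂ R B).independent_maxGenEigenspace
  rw [iSupIndep_iff_finsetSum_eq_imp_eq] at hind
  -- `X = ∑ E w * X` and `X` alone are two decompositions of `X` along independent subspaces, so
  -- their `z`-components agree. The point `z` is inserted because it may lie outside the support.
  have := hind (insert z E.support) (fun w => E w * X) (fun w => if w = z then X else 0) ?_ ?_ z
    (Finset.mem_insert_self _ _)
  · simpa using this
  · intro w _
    refine ⟨(mem_maxGenEigenspace_lmul B _ w).mpr ?_, ?_⟩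
    · obtain ⟨k, hk⟩ := hE w
      exact ⟨k, by rw [← mul_assoc, hk, zero_mul]⟩
    · split_ifs with hw
      · exact (mem_maxGenEigenspace_lmul B _ w).mpr ⟨m, hw ▸ hX⟩
      · exact Submodule.zero_mem _
  · rw [Finset.sum_ite_eq' (insert z E.support) z, if_pos (Finset.mem_insert_self _ _),
      ← Finset.sum_mul]
    rw [Finset.sum_subset (Finset.subset_insert z E.support)] at hsum
    · rw [hsum, one_mul]
    · intro w _ hw
      exact Finsupp.notMem_support_iff.mp hw

/-- Any generalized eigenvector `X` at `z` equals `E z * X`, so a power of `shift B z` that kills `E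
z` kills them all. -/
theorem hasKernelGrowth_shift_iff {B : R} {E : ℂ →₀ R}
    (hE : ∀ z, ∃ k, shift B z ^ k * E z = 0) (hsum : ∑ z ∈ E.support, E z = 1) {z : ℂ} {k : ℕ} :
    HasKernelGrowth (shift B z) k ↔ shift B z ^ k * E z ≠ 0 := by
  constructor
  · rintro ⟨X, h0, h1⟩ h
    rw [← component_mul_eq_self hE hsum h0, ← mul_assoc, h, zero_mul] at h1
    exact h1 rfl
  · intro h
    obtain ⟨m, hm⟩ := hE z
    exact hasKernelGrowth_of_pow_mul hm h

/-- All components away from 0 vanish, so `1 = E 0` is killed by a power of `B`. -/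
theorem isNilpotent_of_spectrum_subset [FiniteDimensional ℂ R] {B : R}
    (h : spectrum ℂ B ⊆ {0}) : IsNilpotent B := by
  obtain ⟨E, hE, hsum⟩ := exists_spectral_decomposition B
  have hz : ∀ z ≠ 0, E z = 0 := by
    intro z hz
    by_contra hne
    refine hz (h (mem_spectrum_of_hasKernelGrowth (k := 0)
      ((hasKernelGrowth_shift_iff hE hsum).mpr ?_)))
    simpa using hne
  have h1 : E 0 = 1 := by
    rw [← hsum]
    by_cases h0 : (0 : ℂ) ∈ E.support
    · exact (Finset.sum_eq_single_of_mem 0 h0 fun z _ hne => hz z hne).symm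
    · rw [Finset.sum_eq_zero]
      · exact Finsupp.notMem_support_iff.mp h0
      · intro z hzs
        exact hz z (fun h => h0 (h ▸ hzs))
  obtain ⟨k, hk⟩ := hE 0
  exact ⟨k, by simpa [shift, h1] using hk⟩

/-- Eigenvectors of the left multiplication for distinct eigenvalues are linearly independent. -/
theorem sum_eigenvectors_ne_zero {B : R} {F : Finset ℂ} (hF : F.Nonempty) {P : ℂ → R}
    (hP : ∀ z ∈ F, P z ≠ 0 ∧ B * P z = z • P z) {c : ℂ → ℂ} (hc : ∀ z ∈ F, c z ≠ 0) :
    ∑ z ∈ F, c z • P z ≠ 0 := by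
  intro h
  have hli := (Algebra.lmul ℂ R B).eigenvectors_linearIndependent (F : Set ℂ) (fun z => P z) ?_
  · rw [Fintype.linearIndependent_iff] at hli
    obtain ⟨z, hz⟩ := hF
    refine hc z hz (hli (fun w => c w) ?_ ⟨z, hz⟩)
    rw [← h]
    exact Finset.sum_coe_sort F (fun z => c z • P z)
  · rintro ⟨z, hz⟩
    rw [Module.End.hasEigenvector_iff, Module.End.mem_eigenspace_iff]
    exact ⟨(hP z hz).2, (hP z hz).1⟩

/-- Binomial expansion of `B ^ n` on a generalized eigenvector. -/
theorem pow_mul_generalized_eigenvector (B E : R) (z : ℂ) {D : ℕ} (hD : shift B z ^ D * E = 0)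
    (n : ℕ) : B ^ n * E =
      ∑ j ∈ Finset.range D, (z ^ (n - j) * (n.choose j : ℂ)) • (shift B z ^ j * E) := by
  have hcomm : Commute (shift B z) (algebraMap ℂ R z) := (Algebra.commutes z _).symm
  have hB : B = shift B z + algebraMap ℂ R z := by simp [shift]
  have hterm : ∀ j, shift B z ^ j * (algebraMap ℂ R z) ^ (n - j) * (n.choose j : R) * E =
      (z ^ (n - j) * (n.choose j : ℂ)) • (shift B z ^ j * E) := by
    intro j
    rw [← map_pow, ← map_natCast (algebraMap ℂ R), mul_assoc (shift B z ^ j), ← map_mul,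
      ← Algebra.commutes, mul_assoc, Algebra.smul_def]
  have h1 : B ^ n * E = ∑ j ∈ Finset.range (n + 1),
      (z ^ (n - j) * (n.choose j : ℂ)) • (shift B z ^ j * E) := by
    conv_lhs => rw [hB]
    rw [hcomm.add_pow, Finset.sum_mul]
    exact Finset.sum_congr rfl fun j _ => hterm j
  have hzero : ∀ j, D ≤ j → shift B z ^ j * E = 0 := by
    intro j hj
    obtain ⟨c, rfl⟩ := Nat.exists_eq_add_of_le hj
    rw [add_comm, pow_add, mul_assoc, hD, mul_zero]
  rw [h1]
  -- Both sums extend to `range (max (n + 1) D)`: terms with `j > n` have zero binomial coefficient,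
  -- terms with `j ≥ D` are killed by `hD`.
  refine (Finset.sum_subset (Finset.range_mono (le_max_left (n + 1) D)) ?_).trans
    (Finset.sum_subset (Finset.range_mono (le_max_right (n + 1) D)) ?_).symm
  · intro j _ hj
    rw [Finset.mem_range, not_lt] at hj
    rw [Nat.choose_eq_zero_of_lt (by omega)]; simp
  · intro j _ hj
    rw [Finset.mem_range, not_lt] at hj
    rw [hzero j hj, smul_zero]

end GeneralizedEigenspaces

/-! ### Jordan indices of real matrices as complex kernel growth. -/

namespace BenfordLinear

variable {d : ℕ}

theorem complexify_mul (A C : Matrix (Fin d) (Fin d) ℝ) :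
    complexify (A * C) = complexify A * complexify C :=
  map_mul Complex.ofRealHom.mapMatrix A C

theorem complexify_pow (A : Matrix (Fin d) (Fin d) ℝ) (n : ℕ) :
    complexify (A ^ n) = complexify A ^ n :=
  map_pow Complex.ofRealHom.mapMatrix A n

theorem complexify_injective : Function.Injective (complexify (d := d)) :=
  Matrix.map_injective Complex.ofReal_injective

theorem complexify_zero : complexify (0 : Matrix (Fin d) (Fin d) ℝ) = 0 :=
  map_zero Complex.ofRealHom.mapMatrix

theorem map_re_complexify_mul (A : Matrix (Fin d) (Fin d) ℝ) (Z : Matrix (Fin d) (Fin d) ℂ) :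
    (complexify A * Z).map Complex.re = A * Z.map Complex.re := by
  ext i j
  simp [Matrix.mul_apply, complexify]

theorem map_im_complexify_mul (A : Matrix (Fin d) (Fin d) ℝ) (Z : Matrix (Fin d) (Fin d) ℂ) :
    (complexify A * Z).map Complex.im = A * Z.map Complex.im := by
  ext i j
  simp [Matrix.mul_apply, complexify]

/-- A real matrix acts separately on real and imaginary parts, so one of the two parts of a complex
witness is a real witness. -/
theorem hasKernelGrowth_complexify_iff {M : Matrix (Fin d) (Fin d) ℝ} {k : ℕ} :
    HasKernelGrowth (complexify M) k ↔ HasKernelGrowth M k := by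
  constructor
  · rintro ⟨Z, h0, h1⟩
    rw [← complexify_pow] at h0 h1
    by_cases hre : M ^ k * Z.map Complex.re = 0
    · refine ⟨Z.map Complex.im, ?_, fun him => h1 ?_⟩
      · rw [← map_im_complexify_mul, h0]; ext; simp
      · rw [← map_re_complexify_mul] at hre
        rw [← map_im_complexify_mul] at him
        ext i j
        exact Complex.ext (congrFun (congrFun hre i) j) (congrFun (congrFun him i) j)
    · exact ⟨Z.map Complex.re, by rw [← map_re_complexify_mul, h0]; ext; simp, hre⟩
  · rintro ⟨X, h0, h1⟩
    refine ⟨complexify X, ?_, ?_⟩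
    · rw [← complexify_pow, ← complexify_mul, h0, complexify_zero]
    · rw [← complexify_pow, ← complexify_mul]
      exact fun h => h1 (complexify_injective (h.trans complexify_zero.symm))

/-- Rank-nullity turns a rank drop into kernel growth. A witness vector becomes a matrix by
repeating it in every column; conversely a column of a witness matrix serves. -/
theorem rank_pow_succ_lt_iff {K : Type*} [Field K] {M : Matrix (Fin d) (Fin d) K} {k : ℕ} :
    (M ^ (k + 1)).rank < (M ^ k).rank ↔ HasKernelGrowth M k := by
  have hrk : ∀ l, (M ^ l).rank + Module.finrank K (LinearMap.ker (M ^ l).mulVecLin) =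
      Module.finrank K (Fin d → K) := fun l =>
    LinearMap.finrank_range_add_finrank_ker _
  have hle : LinearMap.ker (M ^ k).mulVecLin ≤ LinearMap.ker (M ^ (k + 1)).mulVecLin := by
    intro x hx
    rw [LinearMap.mem_ker, Matrix.mulVecLin_apply] at hx ⊢
    rw [pow_succ', ← Matrix.mulVec_mulVec, hx, Matrix.mulVec_zero]
  constructor
  · intro h
    have hne : ¬ LinearMap.ker (M ^ (k + 1)).mulVecLin ≤ LinearMap.ker (M ^ k).mulVecLin := by
      intro hge
      have := hrk k
      have h2 := hrk (k + 1)
      rw [le_antisymm hge hle] at h2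
      omega
    obtain ⟨x, hx1, hx2⟩ := SetLike.not_le_iff_exists.mp hne
    rw [LinearMap.mem_ker, Matrix.mulVecLin_apply] at hx1 hx2
    have hcol : ∀ N : Matrix (Fin d) (Fin d) K, N * Matrix.of (fun i (_ : Fin d) => x i) =
        Matrix.of (fun i (_ : Fin d) => N.mulVec x i) := by
      intro N; ext i j; simp [Matrix.mul_apply, Matrix.mulVec, dotProduct]
    refine ⟨Matrix.of (fun i (_ : Fin d) => x i), ?_, fun h0 => hx2 ?_⟩
    · rw [hcol, hx1]; ext; simp
    · rw [hcol] at h0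
      ext i
      exact congrFun (congrFun h0 i) i
  · rintro ⟨X, h0, h1⟩
    have hlt : LinearMap.ker (M ^ k).mulVecLin < LinearMap.ker (M ^ (k + 1)).mulVecLin := by
      refine lt_of_le_not_ge hle fun hge => h1 ?_
      ext i j
      have hmem : X.col j ∈ LinearMap.ker (M ^ (k + 1)).mulVecLin := by
        rw [LinearMap.mem_ker, Matrix.mulVecLin_apply]
        ext i
        exact congrFun (congrFun h0 i) j
      have := hge hmem
      rw [LinearMap.mem_ker, Matrix.mulVecLin_apply] at this
      exact congrFun this i
    have := Submodule.finrank_lt_finrank_of_lt hlt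
    have h2 := hrk k
    have h3 := hrk (k + 1)
    omega

/-- Growth at `k` forces a rank drop at each of the exponents `0, …, k`, starting from rank at most
`d`. Hence the cap `d - 1` in `jordanIndex` loses nothing. -/
theorem lt_of_hasKernelGrowth {K : Type*} [Field K] {M : Matrix (Fin d) (Fin d) K} {k : ℕ}
    (h : HasKernelGrowth M k) : k < d := by
  have key : ∀ l, HasKernelGrowth M l → (M ^ (l + 1)).rank + (l + 1) ≤ d := by
    intro l
    induction l with
    | zero =>
      intro h
      have := rank_pow_succ_lt_iff.mpr h
      have h2 := (M ^ 0).rank_le_width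
      omega
    | succ l ih =>
      intro h
      have := rank_pow_succ_lt_iff.mpr h
      have h2 := ih h.pred
      omega
  have := key k h
  omega

theorem complexify_factorMatrix_of_real (A : Matrix (Fin d) (Fin d) ℝ) {z : ℂ} (hz : z.im = 0) :
    complexify (factorMatrix A z) = shift (complexify A) z := by
  have hz' : ((z.re : ℝ) : ℂ) = z := Complex.ext rfl hz.symm
  rw [factorMatrix, if_pos hz, shift, Algebra.algebraMap_eq_smul_one]
  ext i j
  by_cases hij : i = j <;> simp [complexify, hij, hz']

theorem complexify_factorMatrix_of_not_real (A : Matrix (Fin d) (Fin d) ℝ) {z : ℂ}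
    (hz : z.im ≠ 0) : complexify (factorMatrix A z) =
      shift (complexify A) z * shift (complexify A) (starRingEnd ℂ z) := by
  have h1 : complexify (factorMatrix A z) = complexify A ^ 2 -
      (2 * (z.re : ℂ)) • complexify A +
        ((‖z‖ ^ 2 : ℝ) : ℂ) • (1 : Matrix (Fin d) (Fin d) ℂ) := by
    rw [← complexify_pow, factorMatrix, if_neg hz]
    ext i j
    by_cases hij : i = j <;> simp [complexify, hij]
  have h2 : (2 * (z.re : ℂ)) = z + starRingEnd ℂ z := by
    rw [Complex.add_conj]; push_cast; rfl
  have h3 : ((‖z‖ ^ 2 : ℝ) : ℂ) = z * starRingEnd ℂ z := by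
    rw [Complex.mul_conj, Complex.normSq_eq_norm_sq]
  rw [h1, h2, h3, shift, shift, Algebra.algebraMap_eq_smul_one, Algebra.algebraMap_eq_smul_one]
  simp only [sub_mul, mul_sub, smul_mul_assoc, mul_smul_comm, one_mul, mul_one, add_smul,
    smul_sub, smul_smul, pow_two]
  rw [mul_comm z]
  abel

theorem mapMatrix_conj_complexify (A : Matrix (Fin d) (Fin d) ℝ) :
    (starRingEnd ℂ).mapMatrix (complexify A) = complexify A := by
  ext i j
  simp [complexify]

theorem mapMatrix_conj_shift (A : Matrix (Fin d) (Fin d) ℝ) (z : ℂ) :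
    (starRingEnd ℂ).mapMatrix (shift (complexify A) z) =
      shift (complexify A) (starRingEnd ℂ z) := by
  rw [shift, map_sub, mapMatrix_conj_complexify, shift]
  congr 1
  ext i j
  by_cases hij : i = j <;> simp [Matrix.algebraMap_matrix_apply, hij]

theorem hasKernelGrowth_conj {A : Matrix (Fin d) (Fin d) ℝ} {z : ℂ} {k : ℕ}
    (h : HasKernelGrowth (shift (complexify A) z) k) :
    HasKernelGrowth (shift (complexify A) (starRingEnd ℂ z)) k := by
  obtain ⟨X, h0, h1⟩ := h
  have hinj : Function.Injective ((starRingEnd ℂ).mapMatrix (m := Fin d)) :=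
    Matrix.map_injective (starRingEnd ℂ).injective
  refine ⟨(starRingEnd ℂ).mapMatrix X, ?_, fun h => h1 (hinj ?_)⟩
  · rw [← mapMatrix_conj_shift, ← map_pow, ← map_mul, h0, map_zero]
  · rw [map_mul, map_pow, mapMatrix_conj_shift, h, map_zero]

theorem commute_shift {R : Type*} [Ring R] [Algebra ℂ R] (B : R) (z w : ℂ) :
    Commute (shift B z) (shift B w) := by
  have h1 : Commute B (algebraMap ℂ R w) := (Algebra.commutes w B).symm
  have h2 : Commute (algebraMap ℂ R z) (shift B w) := Algebra.commutes z _
  exact Commute.sub_left (Commute.sub_right (Commute.refl B) h1) h2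

/-- Without growth at `z`, and so by `hw` at `w`, the two commuting factors can be lowered one after
the other. Conversely `shift B z ^ k * X` is an eigenvector at `z`, on which `shift B w` acts by the
nonzero scalar `z - w`. For conjugate `z`, `w`, symmetry supplies `hw`. -/
theorem hasKernelGrowth_mul_shift_iff {R : Type*} [Ring R] [Algebra ℂ R] {B : R} {z w : ℂ}
    (hzw : z ≠ w) {k : ℕ} (hw : HasKernelGrowth (shift B w) k → HasKernelGrowth (shift B z) k) :
    HasKernelGrowth (shift B z * shift B w) k ↔ HasKernelGrowth (shift B z) k := by
  have hc := commute_shift B z w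
  constructor
  · rintro ⟨X, h0, h1⟩
    by_contra hz
    have hz' : ∀ Y, shift B z ^ (k + 1) * Y = 0 → shift B z ^ k * Y = 0 := fun Y hY => by
      by_contra hne; exact hz ⟨Y, hY, hne⟩
    have hw' : ∀ Y, shift B w ^ (k + 1) * Y = 0 → shift B w ^ k * Y = 0 := fun Y hY => by
      by_contra hne; exact hz (hw ⟨Y, hY, hne⟩)
    rw [hc.mul_pow] at h0 h1
    have h0' : shift B w ^ (k + 1) * (shift B z ^ (k + 1) * X) = 0 := by
      rw [← mul_assoc, ← (hc.pow_pow _ _).eq, h0]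
    -- first reduce the power of `shift B w`, then that of `shift B z`
    have h2 := hw' _ h0'
    have h3 : shift B z ^ (k + 1) * (shift B w ^ k * X) = 0 := by
      rw [← mul_assoc, (hc.pow_pow _ _).eq, mul_assoc, h2]
    exact h1 (by rw [mul_assoc]; exact hz' _ h3)
  · rintro ⟨X, h0, h1⟩
    have heig : ∀ l, shift B w ^ l * (shift B z ^ k * X) = (z - w) ^ l • (shift B z ^ k * X) := by
      intro l
      induction l with
      | zero => simp
      | succ l ih =>
        have hone : shift B w * (shift B z ^ k * X) = (z - w) • (shift B z ^ k * X) := by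
          have : shift B w = shift B z + algebraMap ℂ R (z - w) := by
            simp [shift]
          rw [this, add_mul, ← mul_assoc, ← pow_succ', h0, zero_add, Algebra.smul_def]
        rw [pow_succ, mul_assoc, hone, mul_smul_comm, ih, smul_smul, pow_succ']
    refine ⟨X, ?_, ?_⟩
    · rw [hc.mul_pow, (hc.pow_pow _ _).eq, mul_assoc, h0, mul_zero]
    · rw [hc.mul_pow, (hc.pow_pow _ _).eq, mul_assoc, heig]
      exact smul_ne_zero (pow_ne_zero _ (sub_ne_zero.mpr hzw)) h1

theorem rank_factorMatrix_pow_succ_lt_iff {A : Matrix (Fin d) (Fin d) ℝ} {z : ℂ} {k : ℕ} :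
    (factorMatrix A z ^ (k + 1)).rank < (factorMatrix A z ^ k).rank ↔
      HasKernelGrowth (shift (complexify A) z) k := by
  rw [rank_pow_succ_lt_iff, ← hasKernelGrowth_complexify_iff]
  by_cases hz : z.im = 0
  · rw [complexify_factorMatrix_of_real A hz]
  · rw [complexify_factorMatrix_of_not_real A hz]
    refine hasKernelGrowth_mul_shift_iff (fun h => hz (Complex.conj_eq_iff_im.mp h.symm)) fun h => ?_
    simpa using hasKernelGrowth_conj h

theorem jordanIndex_conj (A : Matrix (Fin d) (Fin d) ℝ) (z : ℂ) :
    jordanIndex A (starRingEnd ℂ z) = jordanIndex A z := by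
  have : factorMatrix A (starRingEnd ℂ z) = factorMatrix A z := by
    simp [factorMatrix]
  rw [jordanIndex, jordanIndex, this]

theorem le_jordanIndex {A : Matrix (Fin d) (Fin d) ℝ} {z : ℂ} {k : ℕ}
    (h : HasKernelGrowth (shift (complexify A) z) k) : k ≤ jordanIndex A z := by
  have := lt_of_hasKernelGrowth h
  exact Nat.le_findGreatest (by omega) (rank_factorMatrix_pow_succ_lt_iff.mpr h)

/-- `Nat.findGreatest` also returns 0 when no exponent qualifies, so the value 0 is excluded here;
at an eigenvalue it is covered by `hasKernelGrowth_zero_of_mem_sigma`. -/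
theorem hasKernelGrowth_jordanIndex {A : Matrix (Fin d) (Fin d) ℝ} {z : ℂ}
    (h : jordanIndex A z ≠ 0) : HasKernelGrowth (shift (complexify A) z) (jordanIndex A z) :=
  rank_factorMatrix_pow_succ_lt_iff.mp (Nat.findGreatest_of_ne_zero
    (P := fun k => (factorMatrix A z ^ (k + 1)).rank < (factorMatrix A z ^ k).rank) rfl h)

end BenfordLinear

/-! ### Asymptotics of the normalized binomial coefficients. -/

section BinomialAsymptotics

theorem tendsto_choose_div_pow (k : ℕ) :
    Tendsto (fun n : ℕ => (n.choose k : ℝ) / (n : ℝ) ^ k) atTop (𝓝 (k.factorial : ℝ)⁻¹) := by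
  have hz : ∀ᶠ n : ℕ in atTop, ((n : ℝ) ^ k / k.factorial : ℝ) ≠ 0 := by
    filter_upwards [eventually_gt_atTop 0] with n hn
    have : (0 : ℝ) < n := by exact_mod_cast hn
    positivity
  have h := ((Asymptotics.isEquivalent_iff_tendsto_one hz).mp
    (isEquivalent_choose k)).mul_const (k.factorial : ℝ)⁻¹
  rw [one_mul] at h
  refine h.congr fun n => ?_
  have : (k.factorial : ℝ) ≠ 0 := by positivity
  simp only [Pi.div_apply]
  field_simp

theorem tendsto_choose_div_pow_of_lt {j k : ℕ} (hjk : j < k) :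
    Tendsto (fun n : ℕ => (n.choose j : ℝ) / (n : ℝ) ^ k) atTop (𝓝 0) := by
  have h1 : Tendsto (fun n : ℕ => ((n : ℝ) ^ (k - j))⁻¹) atTop (𝓝 0) :=
    (tendsto_inv_atTop_zero.comp (tendsto_pow_atTop (by omega))).comp tendsto_natCast_atTop_atTop
  have h := (tendsto_choose_div_pow j).mul h1
  rw [mul_zero] at h
  refine h.congr' ?_
  filter_upwards [eventually_gt_atTop 0] with n hn
  have : (n : ℝ) ≠ 0 := by exact_mod_cast hn.ne'
  have hk : (n : ℝ) ^ k = (n : ℝ) ^ j * (n : ℝ) ^ (k - j) := by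
    rw [← pow_add]; congr 1; omega
  rw [hk]
  field_simp

/-- The coefficient of `(B - z) ^ j` in the binomial expansion of `B ^ n`, normalized by
`r ^ n * n ^ k`. -/
noncomputable def normalizedCoeff (r : ℝ) (k : ℕ) (z : ℂ) (j n : ℕ) : ℂ :=
  ((r ^ n * (n : ℝ) ^ k : ℝ) : ℂ)⁻¹ * (z ^ (n - j) * (n.choose j : ℂ))

theorem normalizedCoeff_eq {r : ℝ} {k : ℕ} {z : ℂ} (hz : z ≠ 0) {j n : ℕ} (hjn : j ≤ n) :
    normalizedCoeff r k z j n =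
      (z ^ j)⁻¹ * (z / r) ^ n * (((n.choose j : ℝ) / (n : ℝ) ^ k : ℝ) : ℂ) := by
  have : z ^ n = z ^ (n - j) * z ^ j := by rw [← pow_add]; congr 1; omega
  rw [normalizedCoeff, div_pow, this]
  push_cast
  rw [div_eq_mul_inv, div_eq_mul_inv, mul_inv]
  have hzj : z ^ j ≠ 0 := pow_ne_zero _ hz
  field_simp

theorem tendsto_normalizedCoeff_of_norm_lt {r : ℝ} (k : ℕ) {z : ℂ} (hz : ‖z‖ < r) (j : ℕ) :
    Tendsto (normalizedCoeff r k z j) atTop (𝓝 0) := by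
  have hr : 0 < r := (norm_nonneg z).trans_lt hz
  by_cases hz0 : z = 0
  · refine tendsto_const_nhds.congr' ?_
    filter_upwards [eventually_gt_atTop j] with n hn
    rw [normalizedCoeff, hz0, zero_pow (by omega)]
    simp
  · have hq : |‖z‖ / r| < 1 := by
      rw [abs_of_nonneg (by positivity), div_lt_one hr]; exact hz
    have h := (tendsto_pow_const_mul_const_pow_of_abs_lt_one j hq).const_mul (‖(z ^ j)⁻¹‖)
    rw [mul_zero] at h
    refine squeeze_zero_norm' ?_ h
    filter_upwards [eventually_gt_atTop 0, eventually_ge_atTop j] with n hn hjn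
    have hn1 : (1 : ℝ) ≤ n := by exact_mod_cast hn
    rw [normalizedCoeff_eq hz0 hjn, norm_mul, norm_mul, norm_pow, norm_div, Complex.norm_real,
      Complex.norm_real, Real.norm_of_nonneg hr.le, Real.norm_of_nonneg (by positivity)]
    rw [mul_assoc, mul_comm ((n : ℝ) ^ j)]
    have h1 : (n.choose j : ℝ) ≤ (n : ℝ) ^ j := by exact_mod_cast Nat.choose_le_pow n j
    have h2 : (n.choose j : ℝ) / (n : ℝ) ^ k ≤ (n : ℝ) ^ j :=
      (div_le_self (by positivity) (one_le_pow₀ hn1)).trans h1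
    gcongr

/-- On the circle `(z / r) ^ n` is unimodular, while `n.choose j / n ^ k` tends to `1 / k!` for `j =
k` and to 0 for `j < k`. -/
theorem tendsto_normalizedCoeff_sub {r : ℝ} (hr : 0 < r) (k : ℕ) {z : ℂ} (hz : ‖z‖ = r) {j : ℕ}
    (hjk : j ≤ k) :
    Tendsto (fun n => normalizedCoeff r k z j n -
      if j = k then (z / r) ^ n * (z ^ k * (k.factorial : ℂ))⁻¹ else 0) atTop (𝓝 0) := by
  have hz0 : z ≠ 0 := by
    rw [← norm_pos_iff, hz]; exact hr
  have hq : ‖z / r‖ = 1 := by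
    rw [norm_div, Complex.norm_real, hz, Real.norm_of_nonneg hr.le, div_self hr.ne']
  have key : Tendsto (fun n : ℕ => (((n.choose j : ℝ) / (n : ℝ) ^ k : ℝ) : ℂ) -
      if j = k then ((k.factorial : ℝ) : ℂ)⁻¹ else 0) atTop (𝓝 0) := by
    split_ifs with h
    · subst h
      have := (Complex.continuous_ofReal.tendsto _).comp (tendsto_choose_div_pow j)
      rw [Complex.ofReal_inv] at this
      simpa using this.sub_const (((j.factorial : ℝ) : ℂ)⁻¹)
    · have := (Complex.continuous_ofReal.tendsto _).comp
        (tendsto_choose_div_pow_of_lt (lt_of_le_of_ne hjk h))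
      simpa [Function.comp_def] using this
  have h := (key.norm).const_mul (‖(z ^ j)⁻¹‖)
  rw [norm_zero, mul_zero] at h
  refine squeeze_zero_norm' ?_ h
  filter_upwards [eventually_ge_atTop j] with n hn
  rw [normalizedCoeff_eq hz0 hn]
  have : (z ^ j)⁻¹ * (z / r) ^ n * (((n.choose j : ℝ) / (n : ℝ) ^ k : ℝ) : ℂ) -
      (if j = k then (z / r) ^ n * (z ^ k * (k.factorial : ℂ))⁻¹ else 0) =
      (z / r) ^ n * ((z ^ j)⁻¹ * ((((n.choose j : ℝ) / (n : ℝ) ^ k : ℝ) : ℂ) -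
      if j = k then ((k.factorial : ℝ) : ℂ)⁻¹ else 0)) := by
    split_ifs with h
    · subst h
      rw [mul_inv, Complex.ofReal_natCast]
      ring
    · ring
  rw [this, norm_mul, norm_pow, hq, one_pow, one_mul, norm_mul]

end BinomialAsymptotics

/-! ### Leading-order asymptotics of powers. -/

section PowerAsymptotics

variable {R : Type*} [Ring R] [Algebra ℂ R]

/-- Leading-order asymptotics of `B ^ n` on one generalized eigenvector. -/
theorem tendsto_normalized_pow_mul [TopologicalSpace R] [ContinuousAdd R] [ContinuousSMul ℂ R]
    {B E : R} {z : ℂ} {r : ℝ} (hr : 0 < r) {k m : ℕ} (hm : shift B z ^ m * E = 0)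
    (hz : ‖z‖ ≤ r) (hk : ‖z‖ = r → shift B z ^ (k + 1) * E = 0) :
    Tendsto (fun n : ℕ => ((r ^ n * (n : ℝ) ^ k : ℝ) : ℂ)⁻¹ • (B ^ n * E) -
      if ‖z‖ = r then (z / r) ^ n • ((z ^ k * (k.factorial : ℂ))⁻¹ • (shift B z ^ k * E)) else 0)
      atTop (𝓝 0) := by
  have hscale : ∀ (D n : ℕ), shift B z ^ D * E = 0 →
      ((r ^ n * (n : ℝ) ^ k : ℝ) : ℂ)⁻¹ • (B ^ n * E) =
        ∑ j ∈ Finset.range D, normalizedCoeff r k z j n • (shift B z ^ j * E) := by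
    intro D n hD
    rw [pow_mul_generalized_eigenvector B E z hD, Finset.smul_sum]
    exact Finset.sum_congr rfl fun j _ => by rw [smul_smul]; rfl
  by_cases hzr : ‖z‖ = r
  · have hsum := tendsto_finsetSum (Finset.range (k + 1)) fun j hj =>
      (tendsto_normalizedCoeff_sub hr k hzr
        (Nat.lt_succ_iff.mp (Finset.mem_range.mp hj))).smul_const (shift B z ^ j * E)
    simp only [zero_smul, Finset.sum_const_zero] at hsum
    refine hsum.congr fun n => ?_
    rw [hscale (k + 1) n (hk hzr), if_pos hzr]
    simp only [sub_smul, Finset.sum_sub_distrib, ite_smul, zero_smul]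
    rw [Finset.sum_ite_eq' (Finset.range (k + 1)) k, if_pos (by simp), smul_smul]
  · have hsum := tendsto_finsetSum (Finset.range m) fun j _ =>
      (tendsto_normalizedCoeff_of_norm_lt k (lt_of_le_of_ne hz hzr) j).smul_const
        (shift B z ^ j * E)
    simp only [zero_smul, Finset.sum_const_zero] at hsum
    refine hsum.congr fun n => ?_
    rw [hscale m n hm, if_neg hzr, sub_zero]

/-- Leading-order asymptotics of `B ^ n`: if `r > 0` is the largest modulus of an eigenvalue and
`k` the largest order of growth over the eigenvalues of modulus `r`, then
`B ^ n / (r ^ n * n ^ k)` is asymptotic to a quasi-periodic sum of eigenvectors. -/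
theorem exists_pow_asymptotics [FiniteDimensional ℂ R] [TopologicalSpace R] [ContinuousAdd R]
    [ContinuousSMul ℂ R] (B : R) {r : ℝ} (hr : 0 < r) (hle : ∀ z ∈ spectrum ℂ B, ‖z‖ ≤ r) {k : ℕ}
    (hk : ∃ z, ‖z‖ = r ∧ HasKernelGrowth (shift B z) k)
    (hmax : ∀ z, ‖z‖ = r → ¬ HasKernelGrowth (shift B z) (k + 1)) :
    ∃ (F : Finset ℂ) (P : ℂ → R), F.Nonempty ∧
      (∀ z ∈ F, ‖z‖ = r ∧ HasKernelGrowth (shift B z) k) ∧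
      (∀ z ∈ F, P z ≠ 0 ∧ B * P z = z • P z) ∧
      Tendsto (fun n : ℕ => ((r ^ n * (n : ℝ) ^ k : ℝ) : ℂ)⁻¹ • B ^ n -
        ∑ z ∈ F, (z / r) ^ n • P z) atTop (𝓝 0) := by
  classical
  obtain ⟨E, hE, hsum⟩ := exists_spectral_decomposition B
  have hgrow : ∀ {z : ℂ} {l : ℕ}, HasKernelGrowth (shift B z) l ↔ shift B z ^ l * E z ≠ 0 :=
    hasKernelGrowth_shift_iff hE hsum
  have hsucc : ∀ z, ‖z‖ = r → shift B z ^ (k + 1) * E z = 0 := fun z hz => by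
    by_contra h; exact hmax z hz (hgrow.mpr h)
  have hsupp : ∀ z ∈ E.support, ‖z‖ ≤ r := fun z hz =>
    hle z (mem_spectrum_of_hasKernelGrowth (k := 0)
      (hgrow.mpr (by simpa using Finsupp.mem_support_iff.mp hz)))
  have hfac : ((k.factorial : ℕ) : ℂ) ≠ 0 := by exact_mod_cast k.factorial_ne_zero
  have hne0 : ∀ z : ℂ, ‖z‖ = r → z ≠ 0 := fun z hz => by
    rw [← norm_pos_iff, hz]; exact hr
  let P : ℂ → R := fun z => (z ^ k * (k.factorial : ℂ))⁻¹ • (shift B z ^ k * E z)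
  let F : Finset ℂ := E.support.filter fun z => ‖z‖ = r ∧ shift B z ^ k * E z ≠ 0
  have hF : ∀ z, z ∈ F ↔ ‖z‖ = r ∧ shift B z ^ k * E z ≠ 0 := fun z => by
    simp only [F, Finset.mem_filter, and_iff_right_iff_imp, Finsupp.mem_support_iff]
    rintro ⟨_, h⟩ h0
    rw [h0, mul_zero] at h
    exact h rfl
  refine ⟨F, P, ?_, ?_, ?_, ?_⟩
  · obtain ⟨z, hz, hgr⟩ := hk
    exact ⟨z, (hF z).mpr ⟨hz, hgrow.mp hgr⟩⟩
  · exact fun z hz => ⟨((hF z).mp hz).1, hgrow.mpr ((hF z).mp hz).2⟩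
  · intro z hz
    obtain ⟨hzr, hne⟩ := (hF z).mp hz
    refine ⟨smul_ne_zero (inv_ne_zero (mul_ne_zero (pow_ne_zero _ (hne0 z hzr)) hfac)) hne, ?_⟩
    -- One more factor `B - z` kills the leading term, which is therefore a genuine eigenvector.
    have h0 := hsucc z hzr
    rw [pow_succ', mul_assoc] at h0
    nth_rewrite 1 [shift] at h0
    rw [sub_mul, sub_eq_zero, ← Algebra.smul_def] at h0
    simp only [P, mul_smul_comm, h0, smul_comm z]
  · have hlim := tendsto_finsetSum E.support fun z hz =>
      tendsto_normalized_pow_mul (B := B) (E := E z) hr (hE z).choose_spec (hsupp z hz)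
        (fun h => hsucc z h)
    simp only [Finset.sum_const_zero] at hlim
    refine hlim.congr fun n => ?_
    rw [Finset.sum_sub_distrib, ← Finset.smul_sum, ← Finset.mul_sum, hsum, mul_one]
    congr 1
    rw [Finset.sum_filter]
    refine Finset.sum_congr rfl fun z _ => ?_
    by_cases h1 : ‖z‖ = r
    · by_cases h2 : shift B z ^ k * E z = 0
      · simp [h1, h2]
      · simp [h1, h2, P]
    · simp [h1]

end PowerAsymptotics

/-! ### Extremal peripheral spectrum, nonresonance and norms. -/

namespace BenfordLinear

variable {d : ℕ}

theorem isNilpotent_of_complexify {B : Matrix (Fin d) (Fin d) ℝ}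
    (h : IsNilpotent (complexify B)) : IsNilpotent B := by
  obtain ⟨k, hk⟩ := h
  exact ⟨k, complexify_injective (by rw [complexify_pow, hk, complexify_zero])⟩

theorem hasKernelGrowth_zero_of_mem_sigma {B : Matrix (Fin d) (Fin d) ℝ} {z : ℂ}
    (hz : z ∈ sigma B) : HasKernelGrowth (shift (complexify B) z) 0 := by
  rw [sigma, spectrum.mem_iff, ← IsUnit.neg_iff, neg_sub, Matrix.isUnit_iff_isUnit_det,
    isUnit_iff_ne_zero, not_not, ← Matrix.exists_mulVec_eq_zero_iff] at hz
  obtain ⟨v, hv, hv0⟩ := hz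
  refine ⟨Matrix.of (fun i (_ : Fin d) => v i), ?_, fun h => hv ?_⟩
  · ext i j
    rw [zero_add, pow_one]
    exact congrFun hv0 i
  · rw [pow_zero, one_mul] at h
    ext i
    exact congrFun (congrFun h i) i

/-- The spectral radius of a non-nilpotent matrix is positive and attained. -/
theorem exists_spectralRadius_eq (hd : 0 < d) {B : Matrix (Fin d) (Fin d) ℝ}
    (hB : ¬ IsNilpotent B) : ∃ r : ℝ, 0 < r ∧ (∀ z ∈ sigma B, ‖z‖ ≤ r) ∧
      (∃ z ∈ sigma B, ‖z‖ = r) ∧ peripheral B = {z | z ∈ sigma B ∧ ‖z‖ = r} := by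
  have : Nonempty (Fin d) := ⟨⟨0, hd⟩⟩
  have hfin : (sigma B).Finite := Matrix.finite_spectrum _
  have hne : (sigma B).Nonempty := spectrum.nonempty_of_isAlgClosed_of_finiteDimensional ℂ _
  obtain ⟨w, hw, hmax⟩ := Set.exists_max_image (sigma B) (fun z => ‖z‖) hfin hne
  have hrad : spectralRadius ℂ (complexify B) = (‖w‖₊ : ENNReal) := by
    refine le_antisymm (iSup₂_le fun z hz => ?_) (le_iSup₂ (f := fun z _ => (‖z‖₊ : ENNReal)) w hw)
    exact ENNReal.coe_le_coe.mpr (hmax z hz)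
  refine ⟨‖w‖, ?_, hmax, ⟨w, hw, rfl⟩, ?_⟩
  · by_contra h
    refine hB (isNilpotent_of_complexify (isNilpotent_of_spectrum_subset fun z hz => ?_))
    have := hmax z hz
    exact norm_le_zero_iff.mp (this.trans (not_lt.mp h))
  · ext z
    simp only [peripheral, Set.mem_ofPred_eq, hrad, ENNReal.coe_inj]
    rw [← NNReal.coe_inj, coe_nnnorm, coe_nnnorm]

theorem conj_mem_sigma {B : Matrix (Fin d) (Fin d) ℝ} {z : ℂ} (hz : z ∈ sigma B) :
    starRingEnd ℂ z ∈ sigma B := by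
  rw [sigma, spectrum.mem_iff] at hz ⊢
  intro hu
  refine hz ?_
  have h1 := hu.map (starRingEnd ℂ).mapMatrix
  have h2 : ∀ w, algebraMap ℂ (Matrix (Fin d) (Fin d) ℂ) w - complexify B =
      -shift (complexify B) w := fun w => by rw [shift, neg_sub]
  rw [h2, map_neg, mapMatrix_conj_shift, Complex.conj_conj, ← h2] at h1
  exact h1

theorem conj_mem_sigmaEP {B : Matrix (Fin d) (Fin d) ℝ} {z : ℂ} (hz : z ∈ sigmaEP B) :
    starRingEnd ℂ z ∈ sigmaEP B := by
  refine ⟨⟨conj_mem_sigma hz.1.1, ?_⟩, ?_⟩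
  · rw [← hz.1.2, ENNReal.coe_inj, ← NNReal.coe_inj, coe_nnnorm, coe_nnnorm, RCLike.norm_conj]
  · rw [jordanIndex_conj]; exact hz.2

/-- Asymptotics of the powers of a non-nilpotent real matrix, with frequencies given by its
extremal peripheral spectrum. -/
theorem exists_sigmaEP_asymptotics (hd : 0 < d) {B : Matrix (Fin d) (Fin d) ℝ}
    (hB : ¬ IsNilpotent B) :
    ∃ (r : ℝ) (k : ℕ) (F : Finset ℂ) (P : ℂ → Matrix (Fin d) (Fin d) ℂ), 0 < r ∧ F.Nonempty ∧
      (∀ z ∈ sigmaEP B, ‖z‖ = r) ∧ (∀ z ∈ F, z ∈ sigmaEP B) ∧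
      (∀ z ∈ F, P z ≠ 0 ∧ complexify B * P z = z • P z) ∧
      Tendsto (fun n : ℕ => ((r ^ n * (n : ℝ) ^ k : ℝ) : ℂ)⁻¹ • complexify B ^ n -
        ∑ z ∈ F, (z / r) ^ n • P z) atTop (𝓝 0) := by
  obtain ⟨r, hr, hle, ⟨w, hw, hwr⟩, hper⟩ := exists_spectralRadius_eq hd hB
  let S : Set ℕ := jordanIndex B '' peripheral B
  have hSne : S.Nonempty := ⟨_, w, by rw [hper]; exact ⟨hw, hwr⟩, rfl⟩
  have hSbdd : BddAbove S := by
    refine ⟨d - 1, ?_⟩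
    rintro _ ⟨z, _, rfl⟩
    exact Nat.findGreatest_le _
  have hlemax : ∀ z ∈ peripheral B, jordanIndex B z ≤ maxJordanIndex B := fun z hz =>
    le_csSup hSbdd ⟨z, hz, rfl⟩
  obtain ⟨v, hv, hvk⟩ : ∃ v ∈ peripheral B, jordanIndex B v = maxJordanIndex B :=
    Nat.sSup_mem hSne hSbdd
  have hmem : ∀ z k, ‖z‖ = r → HasKernelGrowth (shift (complexify B) z) k → z ∈ peripheral B :=
    fun z k hz hg => by rw [hper]; exact ⟨mem_spectrum_of_hasKernelGrowth hg, hz⟩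
  have hvgrow : HasKernelGrowth (shift (complexify B) v) (maxJordanIndex B) := by
    by_cases h0 : jordanIndex B v = 0
    · rw [← hvk, h0]; exact hasKernelGrowth_zero_of_mem_sigma hv.1
    · rw [← hvk]; exact hasKernelGrowth_jordanIndex h0
  have hmax : ∀ z, ‖z‖ = r → ¬ HasKernelGrowth (shift (complexify B) z) (maxJordanIndex B + 1) := by
    intro z hz hg
    have h1 := le_jordanIndex hg
    have h2 := hlemax z (hmem z _ hz hg)
    omega
  have hvr : ‖v‖ = r := by rw [hper] at hv; exact hv.2
  obtain ⟨F, P, hFne, hFg, hP, hlim⟩ := exists_pow_asymptotics (complexify B) hr hle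
    ⟨v, hvr, hvgrow⟩ hmax
  refine ⟨r, maxJordanIndex B, F, P, hr, hFne, ?_, ?_, hP, hlim⟩
  · intro z hz
    have := hz.1
    rw [hper] at this
    exact this.2
  · intro z hz
    obtain ⟨hzr, hg⟩ := hFg z hz
    have hzp := hmem z _ hzr hg
    exact ⟨hzp, le_antisymm (hlemax z hzp) (le_jordanIndex hg)⟩

/-- Nonresonance of the extremal peripheral spectrum excludes integer relations between the
logarithm of its modulus and its arguments. -/
theorem no_integer_relation {b : ℕ} {B : Matrix (Fin d) (Fin d) ℝ} {r : ℝ} (hr : 0 < r)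
    (hon : ∀ z ∈ sigmaEP B, ‖z‖ = r) (hres : Nonresonant b (sigmaEP B)) {F : Finset ℂ}
    (hF : F.Nonempty) (hFs : ∀ z ∈ F, z ∈ sigmaEP B) {h : ℤ} (hh : h ≠ 0) (m : ℂ → ℤ) (l : ℤ) :
    h * Real.logb b r + ∑ z ∈ F, m z * (Complex.arg z / (2 * Real.pi)) ≠ l := by
  intro heq
  have hZ : sigmaEP B ∩ Metric.sphere (0 : ℂ) r = sigmaEP B :=
    Set.inter_eq_left.mpr fun z hz => by simpa using hon z hz
  obtain ⟨w, hw⟩ := hF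
  have hspan : Real.logb b r ∉ Submodule.span ℚ (argDiff (sigmaEP B)) := by
    rcases hres r hr with h1 | h1
    · rw [hZ] at h1; exact h1.2
    · rw [hZ] at h1
      exact absurd (hFs w hw) (h1 ▸ Set.notMem_empty w)
  refine hspan ?_
  set V := Submodule.span ℚ (argDiff (sigmaEP B)) with hV
  have hone : (1 : ℝ) ∈ V := Submodule.subset_span ⟨w, hFs w hw, w, hFs w hw, by simp⟩
  have hsmul : ∀ (q : ℚ) (x : ℝ), x ∈ V → (q : ℝ) * x ∈ V := fun q x hx => by
    rw [← Rat.smul_def]; exact V.smul_mem q hx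
  have hpi : Real.pi ≠ 0 := Real.pi_ne_zero
  -- Comparing `z` with its conjugate puts `2 arg z / (2π)` in the span. For `arg z = π` conjugation
  -- leaves the argument unchanged, but the quotient is then `1 / 2`.
  have harg : ∀ z ∈ F, Complex.arg z / (2 * Real.pi) ∈ V := by
    intro z hz
    by_cases hzpi : Complex.arg z = Real.pi
    · have := hsmul (1 / 2) 1 hone
      convert! this using 1
      rw [hzpi]
      push_cast
      field_simp
    · have h1 : 1 + (Complex.arg z - Complex.arg (starRingEnd ℂ z)) / (2 * Real.pi) ∈ V :=
        Submodule.subset_span ⟨z, hFs z hz, _, conj_mem_sigmaEP (hFs z hz), rfl⟩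
      rw [Complex.arg_conj, if_neg hzpi] at h1
      have := hsmul (1 / 2) _ (V.sub_mem h1 hone)
      convert! this using 1
      push_cast
      field_simp
      ring
  have hsum : ∑ z ∈ F, (m z : ℝ) * (Complex.arg z / (2 * Real.pi)) ∈ V :=
    V.sum_mem fun z hz => by simpa using hsmul (m z : ℚ) _ (harg z hz)
  have hl : (l : ℝ) ∈ V := by simpa using hsmul (l : ℚ) 1 hone
  have := hsmul ((h : ℚ)⁻¹) _ (V.sub_mem hl hsum)
  rw [← heq, add_sub_cancel_right] at this
  have hh' : (h : ℝ) ≠ 0 := by exact_mod_cast hh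
  convert! this using 1
  push_cast
  field_simp

theorem euclideanOpNorm_zero : euclideanOpNorm (0 : Matrix (Fin d) (Fin d) ℝ) = 0 := by
  simp [euclideanOpNorm]

theorem euclideanOpNorm_nonneg (A : Matrix (Fin d) (Fin d) ℝ) : 0 ≤ euclideanOpNorm A :=
  norm_nonneg _

theorem euclideanOpNorm_pos {A : Matrix (Fin d) (Fin d) ℝ} (hA : A ≠ 0) :
    0 < euclideanOpNorm A := by
  rw [euclideanOpNorm, norm_pos_iff]
  exact fun h => hA ((map_eq_zero_iff _ (Matrix.toEuclideanCLM (n := Fin d) (𝕜 := ℝ)).injective).mp h)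

theorem euclideanOpNorm_add_le (A C : Matrix (Fin d) (Fin d) ℝ) :
    euclideanOpNorm (A + C) ≤ euclideanOpNorm A + euclideanOpNorm C := by
  simp only [euclideanOpNorm, map_add]
  exact norm_add_le _ _

theorem euclideanOpNorm_smul {c : ℝ} (hc : 0 ≤ c) (A : Matrix (Fin d) (Fin d) ℝ) :
    euclideanOpNorm (c • A) = c * euclideanOpNorm A := by
  simp only [euclideanOpNorm, map_smul, norm_smul, Real.norm_of_nonneg hc]

theorem continuous_euclideanOpNorm : Continuous (euclideanOpNorm (d := d)) :=
  continuous_norm.comp (LinearMap.continuous_of_finiteDimensional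
    (Matrix.toEuclideanCLM (n := Fin d) (𝕜 := ℝ)).toAlgEquiv.toLinearMap)

/-- A norm on complex matrices that extends the spectral norm on real matrices. -/
noncomputable def splitNorm (X : Matrix (Fin d) (Fin d) ℂ) : ℝ :=
  euclideanOpNorm (X.map Complex.re) + euclideanOpNorm (X.map Complex.im)

/-- At arbitrary torus points the limiting sums need not be real, so a norm on complex matrices is
required. Agreement on real matrices, the triangle inequality and homogeneity under nonnegative real
scalars suffice. -/
theorem splitNorm_complexify (A : Matrix (Fin d) (Fin d) ℝ) :
    splitNorm (complexify A) = euclideanOpNorm A := by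
  have h1 : (complexify A).map Complex.re = A := by ext; simp [complexify]
  have h2 : (complexify A).map Complex.im = 0 := by ext; simp [complexify]
  rw [splitNorm, h1, h2, euclideanOpNorm_zero, add_zero]

theorem splitNorm_nonneg (X : Matrix (Fin d) (Fin d) ℂ) : 0 ≤ splitNorm X :=
  add_nonneg (euclideanOpNorm_nonneg _) (euclideanOpNorm_nonneg _)

theorem splitNorm_zero : splitNorm (0 : Matrix (Fin d) (Fin d) ℂ) = 0 := by
  rw [← complexify_zero, splitNorm_complexify, euclideanOpNorm_zero]

theorem splitNorm_pos {X : Matrix (Fin d) (Fin d) ℂ} (hX : X ≠ 0) : 0 < splitNorm X := by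
  by_contra h
  refine hX ?_
  have h1 := euclideanOpNorm_nonneg (X.map Complex.re)
  have h2 := euclideanOpNorm_nonneg (X.map Complex.im)
  have hre : X.map Complex.re = 0 := by
    by_contra hne
    have := euclideanOpNorm_pos hne
    rw [splitNorm] at h; linarith
  have him : X.map Complex.im = 0 := by
    by_contra hne
    have := euclideanOpNorm_pos hne
    rw [splitNorm] at h; linarith
  ext i j
  exact Complex.ext (congrFun (congrFun hre i) j) (congrFun (congrFun him i) j)

theorem splitNorm_add_le (X Y : Matrix (Fin d) (Fin d) ℂ) :
    splitNorm (X + Y) ≤ splitNorm X + splitNorm Y := by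
  have h1 := euclideanOpNorm_add_le (X.map Complex.re) (Y.map Complex.re)
  have h2 := euclideanOpNorm_add_le (X.map Complex.im) (Y.map Complex.im)
  have h3 : (X + Y).map Complex.re = X.map Complex.re + Y.map Complex.re := by ext; simp
  have h4 : (X + Y).map Complex.im = X.map Complex.im + Y.map Complex.im := by ext; simp
  rw [splitNorm, h3, h4, splitNorm, splitNorm]
  linarith

theorem splitNorm_neg (X : Matrix (Fin d) (Fin d) ℂ) : splitNorm (-X) = splitNorm X := by
  have h3 : (-X).map Complex.re = -X.map Complex.re := by ext; simp
  have h4 : (-X).map Complex.im = -X.map Complex.im := by ext; simp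
  rw [splitNorm, h3, h4]
  simp only [splitNorm, euclideanOpNorm, map_neg, norm_neg]

theorem abs_splitNorm_sub_le (X Y : Matrix (Fin d) (Fin d) ℂ) :
    |splitNorm X - splitNorm Y| ≤ splitNorm (X - Y) := by
  have h1 := splitNorm_add_le (X - Y) Y
  have h2 := splitNorm_add_le (-(X - Y)) X
  rw [splitNorm_neg] at h2
  rw [sub_add_cancel] at h1
  rw [neg_sub, sub_add_cancel] at h2
  rw [abs_le]
  constructor <;> linarith

theorem splitNorm_smul {c : ℝ} (hc : 0 ≤ c) (X : Matrix (Fin d) (Fin d) ℂ) :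
    splitNorm ((c : ℂ) • X) = c * splitNorm X := by
  have h3 : ((c : ℂ) • X).map Complex.re = c • X.map Complex.re := by ext; simp
  have h4 : ((c : ℂ) • X).map Complex.im = c • X.map Complex.im := by ext; simp
  rw [splitNorm, h3, h4, euclideanOpNorm_smul hc, euclideanOpNorm_smul hc, splitNorm, mul_add]

theorem continuous_splitNorm : Continuous (splitNorm (d := d)) :=
  (continuous_euclideanOpNorm.comp (continuous_id.matrix_map Complex.continuous_re)).add
    (continuous_euclideanOpNorm.comp (continuous_id.matrix_map Complex.continuous_im))

end BenfordLinear

/-! ### Logarithmic characters and Weyl sums along torus rotations. -/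

namespace BenfordLinear

variable {d : ℕ}

/-- The character `x ↦ exp (2 π i h log_b x)` of the multiplicative group of positive reals. -/
noncomputable def logChar (b : ℕ) (h : ℤ) (x : ℝ) : ℂ :=
  fourier h ((Real.logb b x : ℝ) : UnitAddCircle)

theorem norm_fourier_apply (h : ℤ) (x : UnitAddCircle) : ‖fourier h x‖ = 1 := by
  rw [fourier_apply, Circle.norm_coe]

theorem fourier_apply_add (h : ℤ) (x y : UnitAddCircle) :
    fourier h (x + y) = fourier h x * fourier h y := by
  rw [fourier_apply, zsmul_add, AddCircle.toCircle_add, Circle.coe_mul, fourier_apply,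
    fourier_apply]

theorem fourier_apply_nsmul (h : ℤ) (x : UnitAddCircle) (n : ℕ) :
    fourier h (n • x) = fourier h x ^ n := by
  induction n with
  | zero => simp
  | succ n ih => rw [succ_nsmul, fourier_apply_add, ih, pow_succ]

theorem norm_logChar (b : ℕ) (h : ℤ) (x : ℝ) : ‖logChar b h x‖ = 1 := norm_fourier_apply _ _

theorem logChar_mul (b : ℕ) (h : ℤ) {x y : ℝ} (hx : x ≠ 0) (hy : y ≠ 0) :
    logChar b h (x * y) = logChar b h x * logChar b h y := by
  rw [logChar, Real.logb_mul hx hy, AddCircle.coe_add, fourier_apply_add, logChar, logChar]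

theorem logChar_one (b : ℕ) (h : ℤ) : logChar b h 1 = 1 := by
  simp [logChar]

theorem logChar_pow (b : ℕ) (h : ℤ) (x : ℝ) (n : ℕ) :
    logChar b h (x ^ n) = logChar b h x ^ n := by
  rw [logChar, Real.logb_pow, ← nsmul_eq_mul, AddCircle.coe_nsmul, fourier_apply_nsmul, logChar]

theorem continuousAt_logChar (b : ℕ) (h : ℤ) {x : ℝ} (hx : x ≠ 0) :
    ContinuousAt (logChar b h) x := by
  have h1 : ContinuousAt (Real.logb b) x := by
    unfold Real.logb
    exact (Real.continuousAt_log hx).div_const _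
  exact (((fourier h).continuous.comp (AddCircle.continuous_mk' 1)).continuousAt).comp h1

/-- `logChar` turns asymptotic equivalence into additive closeness. -/
theorem tendsto_logChar_sub (b : ℕ) (h : ℤ) {x y : ℕ → ℝ} (hy : ∀ᶠ n in atTop, y n ≠ 0)
    (hxy : Tendsto (fun n => x n / y n) atTop (𝓝 1)) :
    Tendsto (fun n => logChar b h (x n) - logChar b h (y n)) atTop (𝓝 0) := by
  have h1 := (continuousAt_logChar b h one_ne_zero).tendsto.comp hxy
  rw [logChar_one] at h1
  have h2 := (h1.sub_const 1).norm
  rw [sub_self, norm_zero] at h2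
  refine squeeze_zero_norm' ?_ h2
  filter_upwards [hy, hxy.eventually_ne one_ne_zero] with n hn hq
  have : logChar b h (x n) = logChar b h (y n) * logChar b h (x n / y n) := by
    rw [← logChar_mul b h hn hq, mul_div_cancel₀ _ hn]
  rw [this, ← mul_sub_one, norm_mul, norm_logChar, one_mul]
  rfl

theorem tendsto_logChar_natCast_pow_succ_sub (b : ℕ) (h : ℤ) (k : ℕ) :
    Tendsto (fun n : ℕ => logChar b h (((n + 1 : ℕ) : ℝ) ^ k) - logChar b h ((n : ℝ) ^ k))
      atTop (𝓝 0) := by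
  refine tendsto_logChar_sub b h ?_ ?_
  · filter_upwards [eventually_gt_atTop 0] with n hn
    have : (n : ℝ) ≠ 0 := by exact_mod_cast hn.ne'
    exact pow_ne_zero _ this
  · have h1 : Tendsto (fun n : ℕ => (1 + ((n : ℝ))⁻¹) ^ k) atTop (𝓝 ((1 + 0) ^ k)) :=
      ((tendsto_inv_atTop_nhds_zero_nat (𝕜 := ℝ)).const_add 1).pow k
    rw [add_zero, one_pow] at h1
    refine h1.congr' ?_
    filter_upwards [eventually_gt_atTop 0] with n hn
    have : (n : ℝ) ≠ 0 := by exact_mod_cast hn.ne'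
    rw [← div_pow]
    push_cast
    rw [add_div, div_self this, one_div]

theorem mFourier_nsmul {ι : Type*} [Fintype ι] (m : ι → ℤ) (θ : UnitAddTorus ι) (n : ℕ) :
    UnitAddTorus.mFourier m (n • θ) = UnitAddTorus.mFourier m θ ^ n := by
  simp only [UnitAddTorus.mFourier, ContinuousMap.coe_mk, Pi.smul_apply, fourier_apply_nsmul,
    Finset.prod_pow]

/-- Weyl sums along a linear flow on a torus, modulated by a geometric sequence that is not in
resonance with the flow and by a slowly varying sequence. -/
theorem meanZero_torus {ι : Type*} [Fintype ι] (θ : UnitAddTorus ι) {ω : ℂ} (hω : ‖ω‖ = 1)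
    (hres : ∀ m : ι → ℤ, ω * UnitAddTorus.mFourier m θ ≠ 1) {s : ℕ → ℂ} (hs : ∀ n, ‖s n‖ ≤ 1)
    (hd : Tendsto (fun n => s (n + 1) - s n) atTop (𝓝 0)) (G : C(UnitAddTorus ι, ℂ)) :
    MeanZero (fun n => ω ^ n * s n * G (n • θ)) := by
  let L : ℕ → C(UnitAddTorus ι, ℂ) →ₗ[ℂ] ℂ := fun n =>
    { toFun := fun g => ω ^ n * s n * g (n • θ)
      map_add' := fun f g => by simp [mul_add]
      map_smul' := fun c f => by simp [mul_left_comm] }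
  refine MeanZero.of_dense_span UnitAddTorus.span_mFourier_closure_eq_top L (K := 1)
    (fun n f => ?_) ?_ G
  · change ‖ω ^ n * s n * f (n • θ)‖ ≤ _
    rw [norm_mul, norm_mul, norm_pow, hω, one_pow, one_mul]
    exact mul_le_mul (hs n) (f.norm_coe_le_norm _) (norm_nonneg _) zero_le_one
  · rintro _ ⟨m, rfl⟩
    have hm : ‖UnitAddTorus.mFourier m θ‖ = 1 := by
      simp only [UnitAddTorus.mFourier, ContinuousMap.coe_mk, norm_prod, norm_fourier_apply,
        Finset.prod_const_one]
    refine (MeanZero.geometric_mul (z := ω * UnitAddTorus.mFourier m θ)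
      (by rw [norm_mul, hω, hm, one_mul]) (hres m) hs hd).congr fun n => ?_
    change _ = ω ^ n * s n * UnitAddTorus.mFourier m (n • θ)
    rw [mFourier_nsmul, mul_pow]
    ring

theorem fourier_one_arg {z : ℂ} {r : ℝ} (hr : 0 < r) (hz : ‖z‖ = r) :
    fourier 1 ((Complex.arg z / (2 * Real.pi) : ℝ) : UnitAddCircle) = z / r := by
  rw [fourier_coe_apply]
  have h1 := Complex.norm_mul_exp_arg_mul_I z
  have hr' : (r : ℂ) ≠ 0 := by exact_mod_cast hr.ne'
  have hpi : (Real.pi : ℂ) ≠ 0 := by exact_mod_cast Real.pi_ne_zero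
  rw [eq_div_iff hr', mul_comm, ← hz]
  conv_rhs => rw [← h1]
  congr 2
  push_cast
  field_simp

/-- The product is `exp (2πi (h * ρ + ∑ m i * x i))`, equal to 1 only at an integer exponent. -/
theorem fourier_mul_mFourier_ne_one {ι : Type*} [Fintype ι] {h : ℤ} {ρ : ℝ} {x : ι → ℝ}
    {m : ι → ℤ} (hne : ∀ l : ℤ, h * ρ + ∑ i, m i * x i ≠ l) :
    fourier h (ρ : UnitAddCircle) *
      UnitAddTorus.mFourier m (fun i => (x i : UnitAddCircle)) ≠ 1 := by
  have hf : ∀ (k : ℤ) (y : ℝ), fourier k (y : UnitAddCircle) =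
      fourier 1 ((k * y : ℝ) : UnitAddCircle) := by
    intro k y
    simp only [fourier_coe_apply]
    congr 1
    push_cast
    ring
  have hsum : ∀ s : Finset ι, ∏ i ∈ s, fourier (m i) (x i : UnitAddCircle) =
      fourier 1 ((∑ i ∈ s, m i * x i : ℝ) : UnitAddCircle) := by
    classical
    intro s
    induction s using Finset.induction_on with
    | empty => simp
    | insert a s ha ih =>
      rw [Finset.prod_insert ha, Finset.sum_insert ha, AddCircle.coe_add, fourier_apply_add, ih,
        hf]
  intro h1
  simp only [UnitAddTorus.mFourier, ContinuousMap.coe_mk] at h1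
  rw [hsum, hf h, ← fourier_apply_add, ← AddCircle.coe_add, fourier_one] at h1
  have h2 := AddCircle.injective_toCircle (T := 1) one_ne_zero
    (a₁ := ((h * ρ + ∑ i, m i * x i : ℝ) : UnitAddCircle)) (a₂ := 0)
    (by rw [AddCircle.toCircle_zero]; exact Circle.ext h1)
  obtain ⟨l, hl⟩ := (AddCircle.coe_eq_zero_iff (p := (1 : ℝ))).mp h2
  exact hne l (by rw [← hl]; simp)

/-- The Weyl sums of the logarithms of `|C * B ^ n|` tend to zero if `σ_EP(B)` is nonresonant and
`C` is a left divisor of a power of `B`. -/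
theorem meanZero_logChar_mul_pow (hd : 0 < d) {b : ℕ} {B C C' : Matrix (Fin d) (Fin d) ℝ}
    (hB : ¬ IsNilpotent B) (hres : Nonresonant b (sigmaEP B)) {l : ℕ} (hC : C' * C = B ^ l)
    {h : ℤ} (hh : h ≠ 0) :
    MeanZero (fun n => logChar b h (euclideanOpNorm (C * B ^ n))) := by
  obtain ⟨r, k, F, P, hr, hFne, hon, hFs, hP, hlim⟩ := exists_sigmaEP_asymptotics hd hB
  have hFr : ∀ z ∈ F, ‖z‖ = r := fun z hz => hon z (hFs z hz)
  have hz0 : ∀ z ∈ F, z ≠ 0 := fun z hz => by rw [← norm_pos_iff, hFr z hz]; exact hr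
  let θ : UnitAddTorus F := fun z => ((Complex.arg z / (2 * Real.pi) : ℝ) : UnitAddCircle)
  -- The phases `(z / r) ^ n` are replaced by independent points of the circle; the orbit `n • θ`
  -- recovers them.
  let S : UnitAddTorus F → Matrix (Fin d) (Fin d) ℂ := fun u =>
    complexify C * ∑ z : F, fourier 1 (u z) • P z
  have hSne : ∀ u, S u ≠ 0 := by
    intro u hu
    -- Multiplying by `C'` replaces `C` by `B ^ l`, which scales each `P z` by `z ^ l ≠ 0`.
    -- Vanishing of `S u` would then contradict the independence of eigenvectors.
    have h1 : complexify C' * S u = ∑ z : F, ((z : ℂ) ^ l * fourier 1 (u z)) • P z := by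
      simp only [S]
      rw [← mul_assoc, ← complexify_mul, hC, complexify_pow, Finset.mul_sum]
      refine Finset.sum_congr rfl fun z _ => ?_
      have heig : ∀ l, complexify B ^ l * P z = (z : ℂ) ^ l • P z := by
        intro l
        induction l with
        | zero => simp
        | succ l ih =>
          rw [pow_succ, mul_assoc, (hP z z.2).2, mul_smul_comm, ih, smul_smul, pow_succ']
      rw [mul_smul_comm, heig, smul_smul, mul_comm]
    rw [hu, mul_zero] at h1
    let c : ℂ → ℂ := fun z => if hz : z ∈ F then z ^ l * fourier 1 (u ⟨z, hz⟩) else 0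
    refine sum_eigenvectors_ne_zero hFne hP (c := c) ?_ ?_
    · intro z hz
      simp only [c, dif_pos hz]
      refine mul_ne_zero (pow_ne_zero _ (hz0 z hz)) ?_
      rw [← norm_pos_iff, norm_fourier_apply]; exact one_pos
    · rw [← Finset.sum_coe_sort F (fun z => c z • P z)]
      refine Eq.trans (Finset.sum_congr rfl fun z _ => ?_) h1.symm
      simp only [c, dif_pos z.2]
  have hScont : Continuous S := by
    refine Continuous.matrix_mul continuous_const (continuous_finsetSum _ fun z _ => ?_)
    exact ((fourier 1).continuous.comp (continuous_apply z)).smul continuous_const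
  have hYcont : Continuous fun u => splitNorm (S u) := continuous_splitNorm.comp hScont
  have hYpos : ∀ u, 0 < splitNorm (S u) := fun u => splitNorm_pos (hSne u)
  -- Compactness bounds `splitNorm (S u)` away from zero, which makes the additive error in the
  -- asymptotics a relative one.
  obtain ⟨u₀, _, hu₀⟩ := isCompact_univ.exists_isMinOn (Set.univ_nonempty)
    (hYcont.continuousOn (s := Set.univ))
  have hc : ∀ u, splitNorm (S u₀) ≤ splitNorm (S u) := fun u => hu₀ (Set.mem_univ u)
  let G : C(UnitAddTorus F, ℂ) := ⟨fun u => logChar b h (splitNorm (S u)),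
    continuous_iff_continuousAt.mpr fun u =>
      ContinuousAt.comp (f := fun u => splitNorm (S u))
        (continuousAt_logChar b h (hYpos u).ne') hYcont.continuousAt⟩
  have hSθ : ∀ n : ℕ, S (n • θ) = complexify C * ∑ z ∈ F, (z / r) ^ n • P z := by
    intro n
    simp only [S]
    rw [← Finset.sum_coe_sort F (fun z => (z / r) ^ n • P z)]
    congr 1
    refine Finset.sum_congr rfl fun z _ => ?_
    rw [Pi.smul_apply, fourier_apply_nsmul, fourier_one_arg hr (hFr z z.2)]
  let X : ℕ → Matrix (Fin d) (Fin d) ℂ := fun n =>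
    complexify C * (((r ^ n * (n : ℝ) ^ k : ℝ) : ℂ)⁻¹ • complexify B ^ n)
  have hXS : Tendsto (fun n => splitNorm (X n - S (n • θ))) atTop (𝓝 0) := by
    have h1 : Tendsto (fun n => X n - S (n • θ)) atTop (𝓝 0) := by
      have h2 : Continuous fun Z : Matrix (Fin d) (Fin d) ℂ => complexify C * Z :=
        Continuous.matrix_mul continuous_const continuous_id
      have h3 := (h2.tendsto 0).comp hlim
      rw [mul_zero] at h3
      refine h3.congr fun n => ?_
      simp only [Function.comp_apply, mul_sub, hSθ, X]
    have := (continuous_splitNorm.tendsto 0).comp h1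
    rwa [splitNorm_zero] at this
  have hratio : Tendsto (fun n => splitNorm (X n) / splitNorm (S (n • θ))) atTop (𝓝 1) := by
    rw [tendsto_iff_norm_sub_tendsto_zero]
    have h1 := hXS.div_const (splitNorm (S u₀))
    rw [zero_div] at h1
    refine squeeze_zero (fun n => norm_nonneg _) (fun n => ?_) h1
    rw [div_sub_one (hYpos _).ne', Real.norm_eq_abs, abs_div, abs_of_pos (hYpos _)]
    exact div_le_div₀ (splitNorm_nonneg _) (abs_splitNorm_sub_le _ _) (hYpos u₀) (hc _)
  have hnorm : ∀ n : ℕ, 0 < n →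
      euclideanOpNorm (C * B ^ n) = r ^ n * (n : ℝ) ^ k * splitNorm (X n) := by
    intro n hn
    have hn' : (0 : ℝ) < n := by exact_mod_cast hn
    have hpos : 0 < r ^ n * (n : ℝ) ^ k := by positivity
    have h1 : X n = (((r ^ n * (n : ℝ) ^ k)⁻¹ : ℝ) : ℂ) • complexify (C * B ^ n) := by
      rw [complexify_mul, complexify_pow, Complex.ofReal_inv]
      simp only [X, mul_smul_comm]
    rw [h1, splitNorm_smul (by positivity), splitNorm_complexify, mul_inv_cancel_left₀ hpos.ne']
  have hmain : MeanZero fun n =>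
      logChar b h r ^ n * logChar b h ((n : ℝ) ^ k) * G (n • θ) := by
    refine meanZero_torus (s := fun n => logChar b h ((n : ℝ) ^ k)) θ (norm_logChar b h r)
      (fun m => ?_) (fun n => (norm_logChar _ _ _).le)
      (tendsto_logChar_natCast_pow_succ_sub b h k) G
    refine fourier_mul_mFourier_ne_one fun l => ?_
    -- The frequency `m` lives on `F` and is extended by zero to all of `ℂ`.
    have := no_integer_relation hr hon hres hFne hFs hh
      (fun z => if hz : z ∈ F then m ⟨z, hz⟩ else 0) l
    rw [← Finset.sum_coe_sort] at this
    simpa using this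
  refine hmain.of_sub_tendsto ?_
  have hdiff := tendsto_logChar_sub b h (Eventually.of_forall fun n => (hYpos (n • θ)).ne') hratio
  refine squeeze_zero_norm' ?_ (by simpa using hdiff.norm)
  filter_upwards [eventually_gt_atTop 0, hratio.eventually_ne one_ne_zero] with n hn hq
  have hn' : (0 : ℝ) < n := by exact_mod_cast hn
  have hX0 : splitNorm (X n) ≠ 0 := fun h0 => hq (by rw [h0, zero_div])
  rw [hnorm n hn, logChar_mul b h (by positivity) hX0, logChar_mul b h (by positivity)
    (by positivity), logChar_pow b h r n]
  change ‖_ - _ * logChar b h (splitNorm (S (n • θ)))‖ ≤ _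
  rw [← mul_sub, norm_mul, norm_mul, norm_pow, norm_logChar, norm_logChar, one_pow, one_mul,
    one_mul]

end BenfordLinear

/-! ### Reduction of the theorem to residue classes modulo `N`. -/

theorem theorem3p10 (d : ℕ) (hd : 0 < d) (A : Matrix (Fin d) (Fin d) ℝ) (b : ℕ) (hb : 2 ≤ b)
    (h : ∃ N : ℕ, 0 < N ∧ BenfordLinear.Nonresonant b (BenfordLinear.sigmaEP (A ^ N))) :
    BenfordLinear.IsBenford b (fun n : ℕ => BenfordLinear.euclideanOpNorm (A ^ n)) ∨
      IsNilpotent A := by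
  obtain ⟨N, hN, hres⟩ := h
  by_cases hA : IsNilpotent A
  · exact Or.inr hA
  refine Or.inl (BenfordLinear.isBenford_of_fourier hb (fun n => ?_) fun k hk => ?_)
  · exact BenfordLinear.euclideanOpNorm_pos fun h0 => hA ⟨n + 1, h0⟩
  · refine MeanZero.of_residues hN (fun n => (BenfordLinear.norm_logChar b k _).le) fun j _ => ?_
    have hAN : ¬ IsNilpotent (A ^ N) := fun ⟨m, hm⟩ => hA ⟨N * m, by rw [pow_mul, hm]⟩
    have hle : j + 1 ≤ N * (j + 1) := Nat.le_mul_of_pos_left _ hN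
    -- Indices start at 1, so class `j` consists of the norms of `A ^ (j + 1) * (A ^ N) ^ n`. The
    -- factor `A ^ (j + 1)` divides `(A ^ N) ^ (j + 1)`, because `j + 1 ≤ N * (j + 1)`.
    have key := BenfordLinear.meanZero_logChar_mul_pow hd (C := A ^ (j + 1))
      (C' := A ^ (N * (j + 1) - (j + 1))) (l := j + 1) hAN hres
      (by rw [← pow_add, Nat.sub_add_cancel hle, pow_mul]) hk
    refine key.congr fun n => ?_
    rw [← pow_mul, ← pow_add, show j + 1 + N * n = N * n + j + 1 by ring]
    rfl
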